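/- Let $\mathcal G$ be a three-dimensional Lie group with nilpotent Lie algebra, $M$ a one-dimensional smooth manifold, $\pi:P\to M$ a smooth principal $\mathcal G$-bundle with adjoint bundle $\mathfrak G$, and $J\subseteq\mathbb R$ an interval. For $t\in J$ let $\bar g(t)$ be smooth $\mathcal G$-invariant Riemannian metrics and $\bar H(t)$ smooth closed $\mathcal G$-invariant three-forms on $P$. **Decomposed data.** Let $\bar A(t)$ be the principal connection whose horizontal spaces are the $\bar g(t)$-orthogonal complements of the vertical spaces. By means of $\bar A(t)$, sections of $\mathcal E=\mathfrak G\oplus TM$ correspond to invariant vector fields on $P$ (vertical fields $\leftrightarrow$ sections of $\mathfrak G$, horizontal fields $\leftrightarrow$ vector fields on $M$). Through this correspondence $\bar g$ becomes a metric $G\oplus g$ on $\mathfrak G\oplus TM$, $\bar H$ becomes $H\in\Gamma(\Lambda^3\mathcal E^*)$, the Lie bracket of vector fields on $P$ becomes a Lie algebroid bracket $[\,,]$ on $\Gamma(\mathcal E)$, with exterior derivative $d$ on $\Gamma(\Lambda^\bullet\mathcal E^*)$, and $\partial\bar A/\partial t$ becomes a section $\partial A/\partial t$ of $T^*M\otimes\mathfrak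 G$. Let $D_v\eta=[v,\eta]$ on $\mathfrak G$, extended to $\mathcal E$ by the Levi-Civita connection of $g$, and let $-F(v,w)$ be the $\mathfrak G$-component of $[v,w]$. Below, $\eta_i$ and $v_\alpha$ are local orthonormal frames of $(\mathfrak G,G)$ and $(TM,g)$, $e_a$ is the combined frame of $\mathcal E$, repeated indices are summed, and $H^2(e,e')=H(e,e_a,e_b)H(e',e_a,e_b)$; $\pi_{\mathfrak G}:\mathcal E\to\mathfrak G$ is the projection and $(a\wedge b)(e,e')=a(e)b(e')-a(e')b(e)$. **Flow.** Suppose that on $J$ the data satisfy the generalized Ricci flow equations in the canonical gauge: for $\eta,\eta'\in\mathfrak G$ and $v,w\in TM$, $$\tfrac{\partial G}{\partial t}(\eta,\eta')=(D_{v_\alpha}DG)_{v_\alpha}(\eta,\eta')-D_{v_\alpha}G(\eta,\eta_l)D_{v_\alpha}G(\eta_l,\eta')-\tfrac12G(F(v_\alpha,v_\beta),\eta)G(F(v_\alpha,v_\beta),\eta')+G([\eta_l,\eta],[\eta_l,\eta'])-\tfrac12G([\eta_l,\eta_m],\eta)G([\eta_l,\eta_m],\eta')+\tfrac12H^2(\eta,\eta'),$$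 $$G\big(\tfrac{\partial A}{\partial t}v,\eta\big)=-G\big((D_{v_\beta}F)(v,v_\beta),\eta\big)-D_{v_\beta}G(F(v,v_\beta),\eta)+D_vG([\eta_j,\eta],\eta_j)+\tfrac12H^2(v,\eta),$$ $$\tfrac{\partial g}{\partial t}(v,w)=-2\,\mathrm{Ric}_g(v,w)+\tfrac12D_vG(\eta_i,\eta_j)D_wG(\eta_i,\eta_j)+G(F(v,v_\gamma),F(w,v_\gamma))+\tfrac12H^2(v,w),$$ and $\partial\bar H/\partial t$, transferred to $\mathcal E$ by the correspondence at time $t$, equals $dB$, where $$B=(D_{v_\alpha}H)(v_\alpha,*,*)-D_{v_\alpha}G(\eta_i,\pi_{\mathfrak G}*)\wedge H(v_\alpha,\eta_i,*)-\tfrac12G(F(v_\alpha,v_\beta),\pi_{\mathfrak G}*)\wedge H(v_\alpha,v_\beta,*)+\tfrac12G([\eta_i,\eta_l],\pi_{\mathfrak G}*)\wedge H(\eta_i,\eta_l,*).$$ (Since $\dim M=1$, the terms with $F$ and $\mathrm{Ric}_g$ vanish.) **Conclusion.** Put $|H^{\mathfrak G}|^2=H(\eta_i,\eta_j,\eta_l)H(\eta_i,\eta_j,\eta_l)$,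 $|[\,,]|^2=G([\eta_i,\eta_j],[\eta_i,\eta_j])$, $|DG(\cdot,\cdot)|^2=\sum_\alpha\big(\sum_iD_{v_\alpha}G(\eta_i,\eta_i)\big)^2$ and $\mathrm{tr}_gH^2=H^2(v_\alpha,v_\alpha)$. Then for every $t\in J$ the function $|H^{\mathfrak G}|^2$ is smooth on $M$, and on $J\times M$ $$\frac{\partial}{\partial t}|H^{\mathfrak G}|^2=\Delta|H^{\mathfrak G}|^2-\tfrac12|H^{\mathfrak G}|^4-|H^{\mathfrak G}|^2\Big(\tfrac12|[\,,]|^2+|DG(\cdot,\cdot)|^2+\mathrm{tr}_gH^2\Big),$$ where $\Delta=\mathrm{tr}_g\nabla d$ is the Laplacian of $(M,g(t))$. (At an endpoint of $J$ time derivatives are one-sided.) -/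

import Mathlib

open scoped Manifold ContDiff

noncomputable section

namespace NilFlow

/-- `ℝⁿ`, the model space of `n`-dimensional manifolds. -/
abbrev Euc (n : ℕ) : Type := EuclideanSpace ℝ (Fin n)

/-- The tangent space of a `d`-dimensional manifold. -/
abbrev Tan {d : ℕ} {P : Type*} [TopologicalSpace P] [ChartedSpace (Euc d) P] (p : P) : Type :=
  TangentSpace 𝓘(ℝ, Euc d) p

/-- Vector fields (no regularity). -/
abbrev VField (d : ℕ) (P : Type*) [TopologicalSpace P] [ChartedSpace (Euc d) P] : Type _ :=
  (p : P) → Tan (d := d) p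

/-- `X` is a smooth vector field on the set `W`. -/
def SmoothVFieldOn {d : ℕ} {P : Type*} [TopologicalSpace P] [ChartedSpace (Euc d) P]
    [IsManifold 𝓘(ℝ, Euc d) ∞ P] (X : VField d P) (W : Set P) : Prop :=
  ContMDiffOn 𝓘(ℝ, Euc d) (𝓘(ℝ, Euc d).tangent) ∞
    (fun p => (⟨p, X p⟩ : TangentBundle 𝓘(ℝ, Euc d) P)) W

/-- The derivative `X[f]` of a function along a vector field. -/
def dirDeriv {d : ℕ} {P : Type*} [TopologicalSpace P] [ChartedSpace (Euc d) P]
    (X : VField d P) (f : P → ℝ) (p : P) : ℝ :=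
  mfderiv 𝓘(ℝ, Euc d) 𝓘(ℝ, ℝ) f p (X p)

/-- The Lie bracket of vector fields. -/
def bracket {d : ℕ} {P : Type*} [TopologicalSpace P] [ChartedSpace (Euc d) P]
    (X Y : VField d P) : VField d P :=
  fun p => VectorField.mlieBracket 𝓘(ℝ, Euc d) X Y p

/-- Smooth Riemannian metrics on `P`. -/
abbrev Metric (d : ℕ) (P : Type*) [TopologicalSpace P] [ChartedSpace (Euc d) P]
    [IsManifold 𝓘(ℝ, Euc d) ∞ P] : Type _ :=
  Bundle.ContMDiffRiemannianMetric 𝓘(ℝ, Euc d) ∞ (Euc d) (fun p : P => Tan (d := d) p)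

/-- Fields of alternating trilinear forms (no regularity). -/
abbrev ThreeForm (d : ℕ) (P : Type*) [TopologicalSpace P] [ChartedSpace (Euc d) P] : Type _ :=
  (p : P) → Tan (d := d) p [⋀^Fin 3]→L[ℝ] ℝ

/-- The function `H(X, Y, Z)`. -/
def evalForm {d : ℕ} {P : Type*} [TopologicalSpace P] [ChartedSpace (Euc d) P]
    (H : ThreeForm d P) (X Y Z : VField d P) (p : P) : ℝ :=
  H p ![X p, Y p, Z p]

/-- A three-form is smooth if its values on smooth local vector fields are smooth functions. -/
def SmoothThreeForm {d : ℕ} {P : Type*} [TopologicalSpace P] [ChartedSpace (Euc d) P]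
    [IsManifold 𝓘(ℝ, Euc d) ∞ P] (H : ThreeForm d P) : Prop :=
  ∀ (W : Set P), IsOpen W → ∀ X Y Z : VField d P,
    SmoothVFieldOn X W → SmoothVFieldOn Y W → SmoothVFieldOn Z W →
      ContMDiffOn 𝓘(ℝ, Euc d) 𝓘(ℝ, ℝ) ∞ (evalForm H X Y Z) W

/-- `dH = 0`, where `dH` is given by the invariant formula for the exterior derivative. -/
def ClosedThreeForm {d : ℕ} {P : Type*} [TopologicalSpace P] [ChartedSpace (Euc d) P]
    [IsManifold 𝓘(ℝ, Euc d) ∞ P] (H : ThreeForm d P) : Prop :=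
  ∀ (W : Set P), IsOpen W → ∀ X : Fin 4 → VField d P, (∀ i, SmoothVFieldOn (X i) W) →
    ∀ p ∈ W,
      dirDeriv (X 0) (evalForm H (X 1) (X 2) (X 3)) p
      - dirDeriv (X 1) (evalForm H (X 0) (X 2) (X 3)) p
      + dirDeriv (X 2) (evalForm H (X 0) (X 1) (X 3)) p
      - dirDeriv (X 3) (evalForm H (X 0) (X 1) (X 2)) p
      - evalForm H (bracket (X 0) (X 1)) (X 2) (X 3) p
      + evalForm H (bracket (X 0) (X 2)) (X 1) (X 3) p
      - evalForm H (bracket (X 0) (X 3)) (X 1) (X 2) p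
      - evalForm H (bracket (X 1) (X 2)) (X 0) (X 3) p
      + evalForm H (bracket (X 1) (X 3)) (X 0) (X 2) p
      - evalForm H (bracket (X 2) (X 3)) (X 0) (X 1) p = 0

instance instLieGroupMinSmoothness {k : ℕ} {𝒢 : Type*} [TopologicalSpace 𝒢]
    [ChartedSpace (Euc k) 𝒢] [Group 𝒢] [LieGroup 𝓘(ℝ, Euc k) ∞ 𝒢] :
    LieGroup 𝓘(ℝ, Euc k) (minSmoothness ℝ 3) 𝒢 := by
  rw [minSmoothness_of_isRCLikeNormedField]; infer_instance

/-- A Lie group is nilpotent if its Lie algebra is nilpotent (this holds in particular if it is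
nilpotent as an abstract group). -/
def NilpotentLieGroup (k : ℕ) (𝒢 : Type*) [TopologicalSpace 𝒢] [ChartedSpace (Euc k) 𝒢]
    [Group 𝒢] [LieGroup 𝓘(ℝ, Euc k) ∞ 𝒢] : Prop :=
  LieRing.IsNilpotent (GroupLieAlgebra 𝓘(ℝ, Euc k) 𝒢)

/-- A smooth principal bundle `π : P → M` with structure group `𝒢` acting on the right. -/
structure PrincipalBundle (k n d : ℕ) (𝒢 P M : Type*)
    [TopologicalSpace 𝒢] [ChartedSpace (Euc k) 𝒢] [Group 𝒢] [LieGroup 𝓘(ℝ, Euc k) ∞ 𝒢]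
    [TopologicalSpace P] [ChartedSpace (Euc d) P] [IsManifold 𝓘(ℝ, Euc d) ∞ P]
    [TopologicalSpace M] [ChartedSpace (Euc n) M] [IsManifold 𝓘(ℝ, Euc n) ∞ M] where
  /-- the projection -/
  proj : P → M
  /-- the right action -/
  act : P → 𝒢 → P
  proj_smooth : ContMDiff 𝓘(ℝ, Euc d) 𝓘(ℝ, Euc n) ∞ proj
  act_smooth : ContMDiff (𝓘(ℝ, Euc d).prod 𝓘(ℝ, Euc k)) 𝓘(ℝ, Euc d) ∞
    (fun x : P × 𝒢 => act x.1 x.2)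
  act_one : ∀ p, act p 1 = p
  act_mul : ∀ p a b, act p (a * b) = act (act p a) b
  proj_act : ∀ p a, proj (act p a) = proj p
  /-- Every point of `M` has an open neighbourhood `U` with an equivariant diffeomorphism
  `p ↦ (π p, φ p)` from `π⁻¹ U` onto `U × 𝒢`, with inverse `(m, a) ↦ s(m) · a`. -/
  locally_trivial : ∀ m : M, ∃ (U : Set M) (s : M → P) (φ : P → 𝒢),
    IsOpen U ∧ m ∈ U ∧
    ContMDiffOn 𝓘(ℝ, Euc n) 𝓘(ℝ, Euc d) ∞ s U ∧
    ContMDiffOn 𝓘(ℝ, Euc d) 𝓘(ℝ, Euc k) ∞ φ (proj ⁻¹' U) ∧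
    (∀ x ∈ U, proj (s x) = x ∧ φ (s x) = 1) ∧
    (∀ p ∈ proj ⁻¹' U, ∀ a, φ (act p a) = φ p * a) ∧
    (∀ p ∈ proj ⁻¹' U, act (s (proj p)) (φ p) = p)

variable {k n d : ℕ} {𝒢 P M : Type*}
  [TopologicalSpace 𝒢] [ChartedSpace (Euc k) 𝒢] [Group 𝒢] [LieGroup 𝓘(ℝ, Euc k) ∞ 𝒢]
  [TopologicalSpace P] [ChartedSpace (Euc d) P] [IsManifold 𝓘(ℝ, Euc d) ∞ P]
  [TopologicalSpace M] [ChartedSpace (Euc n) M] [IsManifold 𝓘(ℝ, Euc n) ∞ M]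

namespace PrincipalBundle

variable (B : PrincipalBundle k n d 𝒢 P M)

theorem proj_surjective : Function.Surjective B.proj := by
  intro m
  obtain ⟨U, s, φ, -, hm, -, -, h, -⟩ := B.locally_trivial m
  exact ⟨s m, (h m hm).1⟩

/-- The differential of the right translation `q ↦ q · a` at `p`. -/
def transl (a : 𝒢) (p : P) : Tan (d := d) p →L[ℝ] Tan (d := d) (B.act p a) :=
  mfderiv 𝓘(ℝ, Euc d) 𝓘(ℝ, Euc d) (fun q => B.act q a) p

/-- The `𝒢`-invariant metrics on `P`. -/
def InvariantMetric (g : Metric d P) : Prop :=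
  ∀ (p : P) (a : 𝒢) (u w : Tan (d := d) p),
    g.inner (B.act p a) (B.transl a p u) (B.transl a p w) = g.inner p u w

/-- The `𝒢`-invariant three-forms on `P`. -/
def InvariantThreeForm (H : ThreeForm d P) : Prop :=
  ∀ (p : P) (a : 𝒢) (u : Fin 3 → Tan (d := d) p),
    H (B.act p a) (fun i => B.transl a p (u i)) = H p u

/-- The value at `p` of the fundamental vector field of the `i`-th vector of the standard basis
`x₁, …, x_k` of the Lie algebra `T₁𝒢 = ℝᵏ`. It represents the element `{p, x_i}` of the fibre of
the adjoint bundle over `π p`, and for fixed `p` these vectors form a basis of `ker dπ_p`. -/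
def fund (p : P) (i : Fin k) : Tan (d := d) p :=
  mfderiv 𝓘(ℝ, Euc k) 𝓘(ℝ, Euc d) (fun a : 𝒢 => B.act p a) 1
    ((EuclideanSpace.single i (1 : ℝ) : Euc k) : TangentSpace 𝓘(ℝ, Euc k) (1 : 𝒢))

/-- The matrix `G_ij = G({p, x_i}, {p, x_j})` of the fibre metric. -/
def gram (g : Metric d P) (p : P) : Matrix (Fin k) (Fin k) ℝ :=
  Matrix.of fun i j => g.inner p (B.fund p i) (B.fund p j)

/-- The vertical part `{p, Ā Z}` of `Z ∈ T_pP`, where `Ā` is the principal connection whose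
horizontal spaces are the `g`-orthogonal complements of the vertical spaces. -/
def vert (g : Metric d P) (p : P) (Z : Tan (d := d) p) : Tan (d := d) p :=
  ∑ i, ∑ j, ((B.gram g p)⁻¹ i j * g.inner p (B.fund p j) Z) • B.fund p i

/-- The horizontal part of `Z ∈ T_pP`, i.e. the horizontal lift of `dπ Z`. -/
def horiz (g : Metric d P) (p : P) (Z : Tan (d := d) p) : Tan (d := d) p :=
  Z - B.vert g p Z

/-- `|H^𝔊|²` computed at a point `p` of `P`, i.e. `G^{ia} G^{jb} G^{lc} H_{ijl} H_{abc}` in the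
basis `{p, x_i}` of the fibre of the adjoint bundle over `π p`. -/
def vertNormSqAt (g : Metric d P) (H : ThreeForm d P) (p : P) : ℝ :=
  ∑ i, ∑ j, ∑ l, ∑ a, ∑ b, ∑ c,
    (B.gram g p)⁻¹ i a * (B.gram g p)⁻¹ j b * (B.gram g p)⁻¹ l c *
      H p ![B.fund p i, B.fund p j, B.fund p l] * H p ![B.fund p a, B.fund p b, B.fund p c]

/-- The function `|H^𝔊|²` on `M`, for invariant `g` and `H`: the value at `m` is computed at any
point over `m`. -/
def vertNormSq (g : Metric d P) (H : ThreeForm d P) (m : M) : ℝ :=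
  B.vertNormSqAt g H (Function.surjInv B.proj_surjective m)

end PrincipalBundle

/-- An orthonormal frame, over the set `U ⊆ M`, of the bundle `𝓔 = 𝔊 ⊕ TM` with the metric
`G ⊕ g` determined by the invariant metric `gbar`, adapted to the splitting. Sections of `𝓔` over
`U` are the smooth invariant vector fields on `π⁻¹ U`; sections of `𝔊` are the vertical ones, and
vector fields on `U` are represented by their horizontal lifts. Thus `e (inl i) = η_i` is an
orthonormal frame of `𝔊` and `e (inr α) = v_α` is (the horizontal lift of) an orthonormal frame of
`TM`; being orthogonal to all vertical vectors, the fields `e (inr α)` are horizontal. -/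
structure Frame (B : PrincipalBundle k n d 𝒢 P M) (gbar : Metric d P) (U : Set M) where
  /-- the vector fields -/
  e : Fin k ⊕ Fin n → VField d P
  smooth : ∀ x, SmoothVFieldOn (e x) (B.proj ⁻¹' U)
  invariant : ∀ x, ∀ p ∈ B.proj ⁻¹' U, ∀ a : 𝒢, e x (B.act p a) = B.transl a p (e x p)
  vertical : ∀ i, ∀ p ∈ B.proj ⁻¹' U,
    mfderiv 𝓘(ℝ, Euc d) 𝓘(ℝ, Euc n) B.proj p (e (Sum.inl i) p) = 0
  orthonormal : ∀ x y, ∀ p ∈ B.proj ⁻¹' U,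
    gbar.inner p (e x p) (e y p) = if x = y then 1 else 0

namespace Frame

variable {B : PrincipalBundle k n d 𝒢 P M} {gbar : Metric d P} {U : Set M}
  (E : Frame B gbar U) (H : ThreeForm d P)

/-! Sections of `𝔊 ⊕ TM` are bracketed as invariant vector fields on `P`, and functions on `M` are
identified with the invariant functions on `P`. All functions below are of this kind. -/

/-- The vertical fields `η_i`. -/
def η (i : Fin k) : VField d P := E.e (Sum.inl i)

/-- The horizontal fields `v_α`. -/
def v (α : Fin n) : VField d P := E.e (Sum.inr α)

/-- The components `⟨[e_x, e_y], e_z⟩` of the bracket of sections of `𝔊 ⊕ TM`. -/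
def C (x y z : Fin k ⊕ Fin n) (p : P) : ℝ :=
  gbar.inner p (bracket (E.e x) (E.e y) p) (E.e z p)

/-- The Levi-Civita connection of the metric `g` on `M`, in components
`Γ_{αβγ} = g(∇_{v_α} v_β, v_γ)`, by the Koszul formula in the orthonormal frame. -/
def Γ (α β γ : Fin n) (p : P) : ℝ :=
  (E.C (Sum.inr α) (Sum.inr β) (Sum.inr γ) p - E.C (Sum.inr β) (Sum.inr γ) (Sum.inr α) p
    + E.C (Sum.inr γ) (Sum.inr α) (Sum.inr β) p) / 2

/-- The connection `D ⊕ ∇` on `𝔊 ⊕ TM`, where `D_v η = [v, η]`, in components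
`⟨D_{v_α} e_x, e_y⟩`. -/
def conn (α : Fin n) : Fin k ⊕ Fin n → Fin k ⊕ Fin n → P → ℝ
  | Sum.inl i, Sum.inl j => E.C (Sum.inr α) (Sum.inl i) (Sum.inl j)
  | Sum.inr β, Sum.inr γ => E.Γ α β γ
  | _, _ => fun _ => 0

/-- The Ricci tensor `Ric_g(v_β, v_γ)` of `(M, g)`, from
`R(v_α, v_β) v_γ = ∇_α ∇_β v_γ - ∇_β ∇_α v_γ - ∇_{[v_α, v_β]} v_γ`. -/
def ric (β γ : Fin n) (p : P) : ℝ :=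
  ∑ α, (dirDeriv (E.v α) (E.Γ β γ α) p - dirDeriv (E.v β) (E.Γ α γ α) p
    + ∑ δ, (E.Γ β γ δ p * E.Γ α δ α p - E.Γ α γ δ p * E.Γ β δ α p
      - E.C (Sum.inr α) (Sum.inr β) (Sum.inr δ) p * E.Γ δ γ α p))

/-- `DG_{αij} = D_{v_α}G(η_i, η_j) = v_α[G(η_i, η_j)] - G([v_α, η_i], η_j) - G(η_i, [v_α, η_j])`. -/
def DG (α : Fin n) (i j : Fin k) (p : P) : ℝ :=
  dirDeriv (E.v α) (fun q => gbar.inner q (E.η i q) (E.η j q)) p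
    - gbar.inner p (bracket (E.v α) (E.η i) p) (E.η j p)
    - gbar.inner p (E.η i p) (bracket (E.v α) (E.η j) p)

/-- `(D_{v_γ}DG)_{v_α}(η_i, η_j)`. -/
def DDG (γ α : Fin n) (i j : Fin k) (p : P) : ℝ :=
  dirDeriv (E.v γ) (E.DG α i j) p - ∑ δ, E.Γ γ α δ p * E.DG δ i j p
    - ∑ l, (E.conn γ (Sum.inl i) (Sum.inl l) p * E.DG α l j p
      + E.conn γ (Sum.inl j) (Sum.inl l) p * E.DG α i l p)

/-- The curvature `F_{αβi} = G(F(v_α, v_β), η_i)`, where `-F(v, w)` is the vertical part of the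
bracket of the horizontal lifts of `v` and `w`. -/
def F (α β : Fin n) (i : Fin k) (p : P) : ℝ :=
  - E.C (Sum.inr α) (Sum.inr β) (Sum.inl i) p

/-- `G((D_{v_γ}F)(v_α, v_β), η_i)`. -/
def DF (γ α β : Fin n) (i : Fin k) (p : P) : ℝ :=
  dirDeriv (E.v γ) (E.F α β i) p
    + ∑ j, E.F α β j p * E.conn γ (Sum.inl j) (Sum.inl i) p
    - ∑ δ, (E.Γ γ α δ p * E.F δ β i p + E.Γ γ β δ p * E.F α δ i p)

/-- `H_{xyz} = H(e_x, e_y, e_z)`. -/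
def Hc (x y z : Fin k ⊕ Fin n) : P → ℝ := evalForm H (E.e x) (E.e y) (E.e z)

/-- `(D_{v_α}H)(e_x, e_y, e_z)`. -/
def DH (α : Fin n) (x y z : Fin k ⊕ Fin n) (p : P) : ℝ :=
  dirDeriv (E.v α) (E.Hc H x y z) p
    - ∑ w, (E.conn α x w p * E.Hc H w y z p + E.conn α y w p * E.Hc H x w z p
      + E.conn α z w p * E.Hc H x y w p)

/-- `H²(e_x, e_y) = ∑ H(e_x, e_z, e_w) H(e_y, e_z, e_w)`. -/
def H2 (x y : Fin k ⊕ Fin n) (p : P) : ℝ :=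
  ∑ z, ∑ w, E.Hc H x z w p * E.Hc H y z w p

/-- `(a(π_𝔊 *) ∧ b(*))(e_x, e_y)` for a one-form `a` on `𝔊` and a one-form `b` on `𝔊 ⊕ TM`, with
`(a ∧ b)(e, f) = a(e) b(f) - a(f) b(e)`. -/
def wedge (a : Fin k → ℝ) (b : Fin k ⊕ Fin n → ℝ) (x y : Fin k ⊕ Fin n) : ℝ :=
  Sum.elim a (fun _ => 0) x * b y - Sum.elim a (fun _ => 0) y * b x

/-- The two-form
`B = D_·H(·, *, *) - D_{·₁}G(·₂, π_𝔊 *) ∧ H(·₁, ·₂, *) - ½ G(F(·₁, ·₂), π_𝔊 *) ∧ H(·₁, ·₂, *)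
  + ½ tr_G G([·₁, ·₂], π_𝔊 *) ∧ H(·₁, ·₂, *)` on `𝔊 ⊕ TM`. -/
def Bc (x y : Fin k ⊕ Fin n) (p : P) : ℝ :=
  ∑ α, E.DH H α (Sum.inr α) x y p
    - ∑ α, ∑ i, wedge (fun j => E.DG α i j p) (fun z => E.Hc H (Sum.inr α) (Sum.inl i) z p) x y
    - (1 / 2) * ∑ α, ∑ β,
        wedge (fun j => E.F α β j p) (fun z => E.Hc H (Sum.inr α) (Sum.inr β) z p) x y
    + (1 / 2) * ∑ i, ∑ l,
        wedge (fun j => E.C (Sum.inl i) (Sum.inl l) (Sum.inl j) p)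
          (fun z => E.Hc H (Sum.inl i) (Sum.inl l) z p) x y

/-- `dB(e_x, e_y, e_z)`, with the exterior derivative of the Lie algebroid `𝔊 ⊕ TM`. -/
def dB (x y z : Fin k ⊕ Fin n) (p : P) : ℝ :=
  dirDeriv (E.e x) (E.Bc H y z) p - dirDeriv (E.e y) (E.Bc H x z) p
    + dirDeriv (E.e z) (E.Bc H x y) p
    - ∑ w, (E.C x y w p * E.Bc H w z p - E.C x z w p * E.Bc H w y p + E.C y z w p * E.Bc H w x p)

/-- The right-hand side of the evolution equation of `G`. -/
def rhsG (i j : Fin k) (p : P) : ℝ :=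
  ∑ α, E.DDG α α i j p
    - ∑ α, ∑ l, E.DG α i l p * E.DG α l j p
    - (1 / 2) * ∑ α, ∑ β, E.F α β i p * E.F α β j p
    + ∑ l, gbar.inner p (bracket (E.η l) (E.η i) p) (bracket (E.η l) (E.η j) p)
    - (1 / 2) * ∑ l, ∑ m, E.C (Sum.inl l) (Sum.inl m) (Sum.inl i) p
        * E.C (Sum.inl l) (Sum.inl m) (Sum.inl j) p
    + (1 / 2) * E.H2 H (Sum.inl i) (Sum.inl j) p

/-- The right-hand side of the evolution equation of the connection, `G(∂A/∂t v_α, η_i)`. -/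
def rhsA (α : Fin n) (i : Fin k) (p : P) : ℝ :=
  - ∑ β, E.DF β α β i p
    - ∑ β, ∑ j, E.F α β j p * E.DG β j i p
    + ∑ j, ∑ l, E.C (Sum.inl j) (Sum.inl i) (Sum.inl l) p * E.DG α l j p
    + (1 / 2) * E.H2 H (Sum.inr α) (Sum.inl i) p

/-- The right-hand side of the evolution equation of `g`. -/
def rhsg (α β : Fin n) (p : P) : ℝ :=
  - 2 * E.ric α β p
    + (1 / 2) * ∑ i, ∑ j, E.DG α i j p * E.DG β i j p
    + ∑ γ, ∑ i, E.F α γ i p * E.F β γ i p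
    + (1 / 2) * E.H2 H (Sum.inr α) (Sum.inr β) p

/-- The Laplacian of `(M, g)`, `Δf = ∑ v_α[v_α[f]] - (∇_{v_α} v_α)[f]`, at the point `π p`. -/
def laplacian (f : M → ℝ) (p : P) : ℝ :=
  ∑ α, (dirDeriv (E.v α) (dirDeriv (E.v α) (f ∘ B.proj)) p
    - ∑ β, E.Γ α α β p * dirDeriv (E.v β) (f ∘ B.proj) p)

/-- `|[,]|² = ∑ G([η_i, η_j], [η_i, η_j])`. -/
def bracketNormSq (p : P) : ℝ :=
  ∑ i, ∑ j, gbar.inner p (bracket (E.η i) (E.η j) p) (bracket (E.η i) (E.η j) p)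

/-- `|DG(·,·)|²`, the square norm of the one-form `tr_G DG` on `M`. -/
def traceDGNormSq (p : P) : ℝ :=
  ∑ α, (∑ i, E.DG α i i p) ^ 2

/-- `tr_g H² = ∑ H²(v_α, v_α)`. -/
def traceH2 (p : P) : ℝ :=
  ∑ α, E.H2 H (Sum.inr α) (Sum.inr α) p

end Frame

/-- `(gbar(t), Hbar(t))`, `t ∈ J`, are invariant metrics and closed invariant three-forms on `P`
that solve the generalized Ricci flow equations in the canonical gauge. The equations are those of
the decomposed data `(G, A, g, H)`; at each time they are written in frames that are orthonormal at
that time. -/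
structure IsSolution (B : PrincipalBundle k n d 𝒢 P M) (J : Set ℝ) (gbar : ℝ → Metric d P)
    (Hbar : ℝ → ThreeForm d P) : Prop where
  metric_invariant : ∀ t ∈ J, B.InvariantMetric (gbar t)
  form_invariant : ∀ t ∈ J, B.InvariantThreeForm (Hbar t)
  form_smooth : ∀ t ∈ J, SmoothThreeForm (Hbar t)
  form_closed : ∀ t ∈ J, ClosedThreeForm (Hbar t)
  /-- `∂G/∂t (η_i, η_j)`: the vertical vectors `η_i(p)` do not depend on the time. -/
  eq_G : ∀ t ∈ J, ∀ U : Set M, IsOpen U → ∀ (E : Frame B (gbar t) U), ∀ p ∈ B.proj ⁻¹' U,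
    ∀ i j, HasDerivWithinAt (fun s => (gbar s).inner p (E.η i p) (E.η j p))
      (E.rhsG (Hbar t) i j p) J t
  /-- `G(∂A/∂t v_α, η_i)`: `{p, ∂Ā/∂t Z}` is the time derivative of the vertical part of `Z`. -/
  eq_A : ∀ t ∈ J, ∀ U : Set M, IsOpen U → ∀ (E : Frame B (gbar t) U), ∀ p ∈ B.proj ⁻¹' U,
    ∀ α i, HasDerivWithinAt (fun s => (gbar t).inner p (B.vert (gbar s) p (E.v α p)) (E.η i p))
      (E.rhsA (Hbar t) α i p) J t
  /-- `∂g/∂t (v_α, v_β)`: at time `s`, the base metric is the metric of horizontal parts. -/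
  eq_g : ∀ t ∈ J, ∀ U : Set M, IsOpen U → ∀ (E : Frame B (gbar t) U), ∀ p ∈ B.proj ⁻¹' U,
    ∀ α β, HasDerivWithinAt (fun s => (gbar s).inner p (B.horiz (gbar s) p (E.v α p))
        (B.horiz (gbar s) p (E.v β p)))
      (E.rhsg (Hbar t) α β p) J t
  /-- `∂Hbar/∂t = dB` -/
  eq_H : ∀ t ∈ J, ∀ U : Set M, IsOpen U → ∀ (E : Frame B (gbar t) U), ∀ p ∈ B.proj ⁻¹' U,
    ∀ x y z, HasDerivWithinAt (fun s => E.Hc (Hbar s) x y z p) (E.dB (Hbar t) x y z p) J t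

end NilFlow

end

/-! With three-dimensional fibres, the vertical part of a three-form is a top form on each fibre of
the adjoint bundle, so `|H^𝔊|² = 6 h² / det G`, where `h` is its value on any basis of the vertical
space and `G` is the Gram matrix of that basis (`vertNormSqAt_eq_of_basis`). The evolution is
computed from this formula in a frame that is orthonormal at the time `t` and is kept fixed as `s`
varies.

Nilpotency enters only through unimodularity: `tr ad = 0` on the Lie algebra, hence `∑ⱼ ⟨[η_i, η_j],
η_j⟩ = 0` (`sum_C_inl`). It is used twice. First, in the purely vertical component of `dB` the
derivatives of the invariant functions `B(e_x, e_y)` vanish, and the coefficients of the remaining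
terms are traces of `ad`; so `∂h/∂t = 0` whatever `B` is (`dB_inl`). Second, `dH = 0` evaluated on
`v, η₀, η₁, η₂` loses all terms in `H(v, η_i, η_j)` and becomes `v[h] = τ h`, with `τ = tr D_v`
(`dirDeriv_h`).

Write `N = |H^𝔊|² = 6 h²`, with `v` the unit field on the base. The second fact gives `ΔN = (2 v[τ]
+ 4 τ²) N` (`laplacian_vertNormSq`). The first gives `∂N/∂t = -N tr(∂G/∂t)`, and the traced equation
for `G` reads `tr(∂G/∂t) = -2 v[τ] + ½|[,]|² + ½N + tr_g H²` (`sum_rhsG`). Since `tr DG = -2τ`, the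
term `4 τ² N` is `|DG(·,·)|² N`, and the formula follows.

The geometric groundwork is naturality of the Lie bracket (`mfderiv_mlieBracket_of_related`). It
shows that frame brackets are invariant, that brackets with a vertical field are vertical, and that
brackets of vertical frame fields are Lie algebra brackets. -/

noncomputable section

namespace NilFlow

open VectorField Filter Set
open scoped Topology

/-! ### Lie brackets of related vector fields -/

section

section Related

variable {E : Type*} [NormedAddCommGroup E] [NormedSpace ℝ E]
  {E' : Type*} [NormedAddCommGroup E'] [NormedSpace ℝ E']

/-- Lie brackets of related vector fields on vector spaces are related. -/
theorem fderiv_lieBracket_of_related {f : E → E'} {V W : E → E} {V' W' : E' → E'} {x : E}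
    (hf : ContDiffAt ℝ 2 f x) (hV : DifferentiableAt ℝ V x) (hW : DifferentiableAt ℝ W x)
    (hV' : DifferentiableAt ℝ V' (f x)) (hW' : DifferentiableAt ℝ W' (f x))
    (hVV' : ∀ᶠ y in 𝓝 x, fderiv ℝ f y (V y) = V' (f y))
    (hWW' : ∀ᶠ y in 𝓝 x, fderiv ℝ f y (W y) = W' (f y)) :
    fderiv ℝ f x (lieBracket ℝ V W x) = lieBracket ℝ V' W' (f x) := by
  have hd : DifferentiableAt ℝ f x := hf.differentiableAt (by norm_num)
  rw [fderiv_apply_lieBracket hf (by simp) hW hV, EventuallyEq.fderiv_eq hWW',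
    EventuallyEq.fderiv_eq hVV']
  have e1 : fderiv ℝ (fun y => W' (f y)) x = (fderiv ℝ W' (f x)).comp (fderiv ℝ f x) :=
    fderiv_comp x hW' hd
  have e2 : fderiv ℝ (fun y => V' (f y)) x = (fderiv ℝ V' (f x)).comp (fderiv ℝ f x) :=
    fderiv_comp x hV' hd
  rw [e1, e2, lieBracket_eq]
  simp [hVV'.self_of_nhds, hWW'.self_of_nhds]

variable {M : Type*} [TopologicalSpace M] [ChartedSpace E M] [IsManifold 𝓘(ℝ, E) ∞ M]
  {M' : Type*} [TopologicalSpace M'] [ChartedSpace E' M'] [IsManifold 𝓘(ℝ, E') ∞ M']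

/-- The expression of a vector field in the chart at `x`. -/
def chartField (x : M) (V : ∀ x : M, TangentSpace 𝓘(ℝ, E) x) : E → E :=
  mpullbackWithin 𝓘(ℝ, E) 𝓘(ℝ, E) (extChartAt 𝓘(ℝ, E) x).symm V (range 𝓘(ℝ, E))

/-- The differentials of a chart and of its inverse are inverse to each other, so pulling back by
the inverse chart is pushing forward by the chart. -/
theorem mfderiv_extChartAt_apply {x y : M} (V : ∀ x : M, TangentSpace 𝓘(ℝ, E) x)
    (hy : y ∈ (extChartAt 𝓘(ℝ, E) x).source) :
    mfderiv 𝓘(ℝ, E) 𝓘(ℝ, E) (extChartAt 𝓘(ℝ, E) x) y (V y)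
      = chartField x V (extChartAt 𝓘(ℝ, E) x y) := by
  have hI := isInvertible_mfderivWithin_extChartAt_symm (I := 𝓘(ℝ, E))
    ((extChartAt 𝓘(ℝ, E) x).map_source hy)
  have hc := mfderivWithin_extChartAt_symm_comp_mfderiv_extChartAt' (I := 𝓘(ℝ, E)) hy
  have hxy : (extChartAt 𝓘(ℝ, E) x).symm (extChartAt 𝓘(ℝ, E) x y) = y :=
    (extChartAt 𝓘(ℝ, E) x).left_inv hy
  unfold chartField
  rw [mpullbackWithin_apply, eq_comm, hI.inverse_apply_eq]
  have := DFunLike.congr_fun hc (V y)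
  change _ = V y at this
  refine Eq.trans ?_ this.symm
  rw [hxy]

/-- The manifold bracket is by definition the chart bracket moved back by the inverse of this
differential. -/
theorem mfderiv_extChartAt_mlieBracket (x : M) (V W : ∀ x : M, TangentSpace 𝓘(ℝ, E) x) :
    mfderiv 𝓘(ℝ, E) 𝓘(ℝ, E) (extChartAt 𝓘(ℝ, E) x) x (mlieBracket 𝓘(ℝ, E) V W x)
      = lieBracket ℝ (chartField x V) (chartField x W) (extChartAt 𝓘(ℝ, E) x x) := by
  rw [← mlieBracketWithin_univ, mlieBracketWithin_apply]
  have hI := isInvertible_mfderiv_extChartAt (I := 𝓘(ℝ, E)) (mem_extChartAt_source (I := 𝓘(ℝ, E)) x)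
  refine (hI.self_apply_inverse _).trans ?_
  have hu : (extChartAt 𝓘(ℝ, E) x).symm ⁻¹' univ ∩ range 𝓘(ℝ, E) = univ := by simp
  rw [hu]
  exact congrFun (lieBracketWithin_univ (V := chartField x V) (W := chartField x W)) _

variable [CompleteSpace E] [CompleteSpace E']

theorem differentiableAt_chartField {x : M} {V : ∀ x : M, TangentSpace 𝓘(ℝ, E) x}
    (hV : MDifferentiableAt 𝓘(ℝ, E) 𝓘(ℝ, E).tangent
      (fun y => (⟨y, V y⟩ : TangentBundle 𝓘(ℝ, E) M)) x) :
    DifferentiableAt ℝ (chartField x V) (extChartAt 𝓘(ℝ, E) x x) := by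
  have : IsManifold 𝓘(ℝ, E) 2 M := IsManifold.of_le (n := ∞) (by norm_cast)
  have := MDifferentiableWithinAt.differentiableWithinAt_mpullbackWithin_vectorField
    (s := univ) hV.mdifferentiableWithinAt
  rw [← differentiableWithinAt_univ]
  have hu : (extChartAt 𝓘(ℝ, E) x).symm ⁻¹' univ ∩ range 𝓘(ℝ, E) = univ := by simp
  rwa [hu] at this

/-- Lie brackets of related vector fields are related. -/
theorem mfderiv_mlieBracket_of_related {f : M → M'} {V W : ∀ x : M, TangentSpace 𝓘(ℝ, E) x}
    {V' W' : ∀ x : M', TangentSpace 𝓘(ℝ, E') x} {x : M}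
    (hf : ContMDiffAt 𝓘(ℝ, E) 𝓘(ℝ, E') ∞ f x)
    (hV : MDifferentiableAt 𝓘(ℝ, E) 𝓘(ℝ, E).tangent
      (fun y => (⟨y, V y⟩ : TangentBundle 𝓘(ℝ, E) M)) x)
    (hW : MDifferentiableAt 𝓘(ℝ, E) 𝓘(ℝ, E).tangent
      (fun y => (⟨y, W y⟩ : TangentBundle 𝓘(ℝ, E) M)) x)
    (hV' : MDifferentiableAt 𝓘(ℝ, E') 𝓘(ℝ, E').tangent
      (fun y => (⟨y, V' y⟩ : TangentBundle 𝓘(ℝ, E') M')) (f x))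
    (hW' : MDifferentiableAt 𝓘(ℝ, E') 𝓘(ℝ, E').tangent
      (fun y => (⟨y, W' y⟩ : TangentBundle 𝓘(ℝ, E') M')) (f x))
    (hVV' : ∀ᶠ y in 𝓝 x, mfderiv 𝓘(ℝ, E) 𝓘(ℝ, E') f y (V y) = V' (f y))
    (hWW' : ∀ᶠ y in 𝓝 x, mfderiv 𝓘(ℝ, E) 𝓘(ℝ, E') f y (W y) = W' (f y)) :
    mfderiv 𝓘(ℝ, E) 𝓘(ℝ, E') f x (mlieBracket 𝓘(ℝ, E) V W x)
      = mlieBracket 𝓘(ℝ, E') V' W' (f x) := by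
  have hxs := mem_extChartAt_source (I := 𝓘(ℝ, E)) x
  have hfs := mem_extChartAt_source (I := 𝓘(ℝ, E')) (f x)
  set φ := extChartAt 𝓘(ℝ, E) x with hφ
  set ψ := extChartAt 𝓘(ℝ, E') (f x) with hψ
  let F : E → E' := fun u => ψ (f (φ.symm u))
  have hφx : φ.symm (φ x) = x := φ.left_inv hxs
  have hFx : F (φ x) = ψ (f x) := by simp only [F, hφx]
  have hfx : MDifferentiableAt 𝓘(ℝ, E) 𝓘(ℝ, E') f x := hf.mdifferentiableAt (by simp)
  have hF : ContDiffAt ℝ ∞ F (φ x) := by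
    have := (contMDiffAt_iff (n := ∞)).1 hf |>.2
    have hu : range 𝓘(ℝ, E) = univ := by simp
    rw [hu, contDiffWithinAt_univ] at this
    exact this
  have hFd : ∀ᶠ u in 𝓝 (φ x), DifferentiableAt ℝ F u := by
    have := (hF.of_le (m := 1) (by norm_cast)).eventually (by simp)
    filter_upwards [this] with u hu using hu.differentiableAt (by simp)
  -- Relatedness along `f` passes to relatedness of the chart expressions along `F`, which reduces
  -- the claim to vector spaces.
  have key : ∀ {X : ∀ x : M, TangentSpace 𝓘(ℝ, E) x} {X' : ∀ x : M', TangentSpace 𝓘(ℝ, E') x},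
      (∀ᶠ y in 𝓝 x, mfderiv 𝓘(ℝ, E) 𝓘(ℝ, E') f y (X y) = X' (f y)) →
      ∀ᶠ u in 𝓝 (φ x), fderiv ℝ F u (chartField x X u) = chartField (f x) X' (F u) := by
    intro X X' h
    have hc : Tendsto φ.symm (𝓝 (φ x)) (𝓝 x) := by
      have := continuousAt_extChartAt_symm (I := 𝓘(ℝ, E)) x
      rw [ContinuousAt, ← hφ, hφx] at this
      exact this
    have hm : ∀ᶠ y in 𝓝 x, MDifferentiableAt 𝓘(ℝ, E) 𝓘(ℝ, E') f y := by
      have := (contMDiffAt_iff_contMDiffAt_nhds (n := 1) (by simp)).1 (hf.of_le (by norm_cast))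
      filter_upwards [this] with u hu using hu.mdifferentiableAt (by simp)
    have hs : ∀ᶠ y in 𝓝 x, f y ∈ ψ.source :=
      hf.continuousAt.eventually (extChartAt_source_mem_nhds (I := 𝓘(ℝ, E')) (f x))
    filter_upwards [hc.eventually h, hc.eventually hm, hc.eventually hs, hFd,
      extChartAt_target_mem_nhds (I := 𝓘(ℝ, E)) x] with u h1 h2 h3 h4 h5
    have h6 : φ.symm u ∈ φ.source := φ.map_target h5
    have h7 : φ (φ.symm u) = u := φ.right_inv h5
    generalize φ.symm u = y at *
    subst h7
    have e1 : F (φ y) = ψ (f y) := by simp only [F, φ.left_inv h6]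
    rw [e1, ← mfderiv_extChartAt_apply X h6, ← mfderiv_extChartAt_apply X' h3, ← h1]
    have hψd : MDifferentiableAt 𝓘(ℝ, E') 𝓘(ℝ, E') ψ (f y) :=
      mdifferentiableAt_extChartAt (by simpa [hψ] using h3)
    have hφd : MDifferentiableAt 𝓘(ℝ, E) 𝓘(ℝ, E) φ y :=
      mdifferentiableAt_extChartAt (by simpa [hφ] using h6)
    have e2 := mfderiv_comp y hψd h2
    have e3 := mfderiv_comp y h4.mdifferentiableAt hφd
    have e4 : (F ∘ φ) =ᶠ[𝓝 y] (ψ ∘ f) := by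
      filter_upwards [(isOpen_extChartAt_source (I := 𝓘(ℝ, E)) x).mem_nhds h6] with z hz
      simp only [F, Function.comp, φ.left_inv hz]
    rw [e4.mfderiv_eq, e2] at e3
    rw [← mfderiv_eq_fderiv]
    exact (DFunLike.congr_fun e3 (X y)).symm
  have hI := isInvertible_mfderiv_extChartAt hfs
  have hL := fderiv_lieBracket_of_related (hF.of_le (by norm_cast))
    (differentiableAt_chartField hV) (differentiableAt_chartField hW)
    (by rw [hFx]; exact differentiableAt_chartField hV')
    (by rw [hFx]; exact differentiableAt_chartField hW') (key hVV') (key hWW')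
  rw [hFx, ← mfderiv_extChartAt_mlieBracket, ← mfderiv_extChartAt_mlieBracket] at hL
  have hψd : MDifferentiableAt 𝓘(ℝ, E') 𝓘(ℝ, E') ψ (f x) :=
    mdifferentiableAt_extChartAt (by simp)
  have hφd : MDifferentiableAt 𝓘(ℝ, E) 𝓘(ℝ, E) φ x :=
    mdifferentiableAt_extChartAt (by simp)
  have e2 := mfderiv_comp x hψd hfx
  have e3 := mfderiv_comp x hFd.self_of_nhds.mdifferentiableAt hφd
  have e4 : (F ∘ φ) =ᶠ[𝓝 x] (ψ ∘ f) := by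
    filter_upwards [(isOpen_extChartAt_source (I := 𝓘(ℝ, E)) x).mem_nhds hxs] with z hz
    simp only [F, Function.comp, φ.left_inv hz]
  rw [e4.mfderiv_eq, e2] at e3
  -- The differential of the target chart is injective, so it is enough to compare the two sides in
  -- the chart.
  apply hI.injective
  rw [← mfderiv_eq_fderiv] at hL
  exact (DFunLike.congr_fun e3 _).trans hL

end Related

end

/-! ### Derivatives along vector fields; smoothness of brackets and inner products -/

section

section DirDeriv

variable {d : ℕ} {P : Type*} [TopologicalSpace P] [ChartedSpace (Euc d) P]

theorem dirDeriv_congr {X : VField d P} {f g : P → ℝ} {p : P} (h : f =ᶠ[𝓝 p] g) :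
    dirDeriv X f p = dirDeriv X g p := by
  unfold dirDeriv
  rw [h.mfderiv_eq]
  rfl

theorem dirDeriv_const (X : VField d P) (c : ℝ) (p : P) : dirDeriv X (fun _ => c) p = 0 := by
  unfold dirDeriv
  rw [mfderiv_const]
  rfl

theorem dirDeriv_mul {X : VField d P} {f g : P → ℝ} {p : P}
    (hf : MDifferentiableAt 𝓘(ℝ, Euc d) 𝓘(ℝ, ℝ) f p)
    (hg : MDifferentiableAt 𝓘(ℝ, Euc d) 𝓘(ℝ, ℝ) g p) :
    dirDeriv X (fun q => f q * g q) p = f p * dirDeriv X g p + dirDeriv X f p * g p := by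
  unfold dirDeriv
  have := (hf.hasMFDerivAt.mul hg.hasMFDerivAt).mfderiv
  change mfderiv 𝓘(ℝ, Euc d) 𝓘(ℝ, ℝ) (f * g) p (X p) = _
  rw [this]
  change f p * _ + g p * _ = _
  rw [mul_comm (g p)]
  rfl

theorem dirDeriv_sum {ι : Type*} [Fintype ι] {X : VField d P} {f : ι → P → ℝ} {p : P}
    (hf : ∀ i, MDifferentiableAt 𝓘(ℝ, Euc d) 𝓘(ℝ, ℝ) (f i) p) :
    dirDeriv X (fun q => ∑ i, f i q) p = ∑ i, dirDeriv X (f i) p := by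
  classical
  have key : ∀ s : Finset ι, MDifferentiableAt 𝓘(ℝ, Euc d) 𝓘(ℝ, ℝ) (fun q => ∑ i ∈ s, f i q) p ∧
      dirDeriv X (fun q => ∑ i ∈ s, f i q) p = ∑ i ∈ s, dirDeriv X (f i) p := by
    intro s
    induction s using Finset.induction_on with
    | empty => simpa using ⟨mdifferentiableAt_const, dirDeriv_const X 0 p⟩
    | insert a s ha ih =>
      simp only [Finset.sum_insert ha]
      refine ⟨(hf a).add ih.1, ?_⟩
      rw [← ih.2]
      have := ((hf a).hasMFDerivAt.add ih.1.hasMFDerivAt).mfderiv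
      unfold dirDeriv
      change mfderiv 𝓘(ℝ, Euc d) 𝓘(ℝ, ℝ) (f a + fun q => ∑ i ∈ s, f i q) p (X p) = _
      rw [this]
      rfl
  exact (key Finset.univ).2

theorem dirDeriv_const_mul {X : VField d P} {f : P → ℝ} {p : P} (c : ℝ)
    (hf : MDifferentiableAt 𝓘(ℝ, Euc d) 𝓘(ℝ, ℝ) f p) :
    dirDeriv X (fun q => c * f q) p = c * dirDeriv X f p := by
  rw [dirDeriv_mul mdifferentiableAt_const hf, dirDeriv_const]
  ring

variable [IsManifold 𝓘(ℝ, Euc d) ∞ P]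

theorem SmoothVFieldOn.mdifferentiableAt {X : VField d P} {W : Set P} (hX : SmoothVFieldOn X W)
    (hW : IsOpen W) {p : P} (hp : p ∈ W) :
    MDifferentiableAt 𝓘(ℝ, Euc d) 𝓘(ℝ, Euc d).tangent
      (fun q => (⟨q, X q⟩ : TangentBundle 𝓘(ℝ, Euc d) P)) p :=
  ((hX p hp).contMDiffAt (hW.mem_nhds hp)).mdifferentiableAt (by simp)

theorem SmoothVFieldOn.bracket {X Y : VField d P} {W : Set P} (hX : SmoothVFieldOn X W)
    (hY : SmoothVFieldOn Y W) (hW : IsOpen W) : SmoothVFieldOn (bracket X Y) W := by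
  intro p hp
  have h1 := (hX p hp).contMDiffAt (hW.mem_nhds hp)
  have h2 := (hY p hp).contMDiffAt (hW.mem_nhds hp)
  have : IsManifold 𝓘(ℝ, Euc d) (((⊤ : ℕ∞) : ℕ∞ω) + 1) P := by simpa using ‹IsManifold 𝓘(ℝ, Euc d) ∞ P›
  have : IsManifold 𝓘(ℝ, Euc d) (minSmoothness ℝ 2) P := by
    rw [minSmoothness_of_isRCLikeNormedField]
    exact IsManifold.of_le (n := ∞) (by norm_cast)
  exact (ContMDiffAt.mlieBracket_vectorField (n := ⊤) (m := ⊤) h1 h2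
    (by rw [minSmoothness_of_isRCLikeNormedField]; simp)).contMDiffWithinAt

theorem contMDiffOn_inner (g : Metric d P) {X Y : VField d P} {W : Set P}
    (hX : SmoothVFieldOn X W) (hY : SmoothVFieldOn Y W) :
    ContMDiffOn 𝓘(ℝ, Euc d) 𝓘(ℝ, ℝ) ∞ (fun p => g.inner p (X p) (Y p)) W := by
  intro p hp
  have := ContMDiffWithinAt.clm_bundle_apply₂ (F₃ := ℝ) (E₃ := Bundle.Trivial P ℝ) (b := id)
    (ψ := fun p => g.inner p) ((g.contMDiff p).contMDiffWithinAt (s := W)) (hX p hp) (hY p hp)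
  simp only [Bundle.contMDiffWithinAt_totalSpace] at this
  exact this.2

end DirDeriv

end

/-! ### Vertical vectors, orbits and invariant functions on a principal bundle -/

section

section LeftInverse

variable {E E' : Type*} [NormedAddCommGroup E] [NormedSpace ℝ E]
  [NormedAddCommGroup E'] [NormedSpace ℝ E']
  {M : Type*} [TopologicalSpace M] [ChartedSpace E M]
  {M' : Type*} [TopologicalSpace M'] [ChartedSpace E' M']

/-- A chain rule in which the middle point is a separate variable `y`, for cases such as `act p 1 =
p` where the base points agree only propositionally. -/
theorem mfderiv_comp_apply_eq {E'' : Type*} [NormedAddCommGroup E''] [NormedSpace ℝ E'']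
    {M'' : Type*} [TopologicalSpace M''] [ChartedSpace E'' M'']
    {f : M → M'} {h : M' → M''} {x : M} {y : M'} (hy : f x = y)
    (hf : MDifferentiableAt 𝓘(ℝ, E) 𝓘(ℝ, E') f x)
    (hh : MDifferentiableAt 𝓘(ℝ, E') 𝓘(ℝ, E'') h y) (v : E) :
    (mfderiv 𝓘(ℝ, E') 𝓘(ℝ, E'') h y (mfderiv 𝓘(ℝ, E) 𝓘(ℝ, E') f x v : E') : E'')
      = mfderiv 𝓘(ℝ, E) 𝓘(ℝ, E'') (fun z => h (f z)) x v := by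
  subst hy
  exact (DFunLike.congr_fun (mfderiv_comp x hh hf) v).symm

theorem mfderiv_leftInverse {f : M → M'} {h : M' → M} {x : M} {y : M'} (hy : f x = y)
    (hf : MDifferentiableAt 𝓘(ℝ, E) 𝓘(ℝ, E') f x)
    (hh : MDifferentiableAt 𝓘(ℝ, E') 𝓘(ℝ, E) h y)
    (hhf : ∀ᶠ z in 𝓝 x, h (f z) = z) (v : E) :
    (mfderiv 𝓘(ℝ, E') 𝓘(ℝ, E) h y (mfderiv 𝓘(ℝ, E) 𝓘(ℝ, E') f x v : E') : E) = v := by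
  have h2 : (fun z => h (f z)) =ᶠ[𝓝 x] id := hhf
  rw [mfderiv_comp_apply_eq hy hf hh, h2.mfderiv_eq, mfderiv_id]
  rfl

end LeftInverse

variable {k n d : ℕ} {𝒢 P M : Type*}
  [TopologicalSpace 𝒢] [ChartedSpace (Euc k) 𝒢] [Group 𝒢] [LieGroup 𝓘(ℝ, Euc k) ∞ 𝒢]
  [TopologicalSpace P] [ChartedSpace (Euc d) P] [IsManifold 𝓘(ℝ, Euc d) ∞ P]
  [TopologicalSpace M] [ChartedSpace (Euc n) M] [IsManifold 𝓘(ℝ, Euc n) ∞ M]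

namespace PrincipalBundle

variable (B : PrincipalBundle k n d 𝒢 P M)

/-- The differential of the projection. -/
def dproj (p : P) : Euc d →L[ℝ] Euc n :=
  mfderiv 𝓘(ℝ, Euc d) 𝓘(ℝ, Euc n) B.proj p

/-- The differential at `1` of the orbit map `a ↦ p · a`. -/
def dorbit (p : P) : Euc k →L[ℝ] Euc d :=
  mfderiv 𝓘(ℝ, Euc k) 𝓘(ℝ, Euc d) (fun a : 𝒢 => B.act p a) 1

theorem contMDiff_act_left (p : P) :
    ContMDiff 𝓘(ℝ, Euc k) 𝓘(ℝ, Euc d) ∞ (fun a : 𝒢 => B.act p a) :=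
  B.act_smooth.comp (contMDiff_const.prodMk contMDiff_id)

theorem contMDiff_act_right (a : 𝒢) :
    ContMDiff 𝓘(ℝ, Euc d) 𝓘(ℝ, Euc d) ∞ (fun p : P => B.act p a) :=
  B.act_smooth.comp (contMDiff_id.prodMk contMDiff_const)

theorem mdifferentiable_proj : MDifferentiable 𝓘(ℝ, Euc d) 𝓘(ℝ, Euc n) B.proj :=
  B.proj_smooth.mdifferentiable (by simp)

theorem mdifferentiable_act_left (p : P) :
    MDifferentiable 𝓘(ℝ, Euc k) 𝓘(ℝ, Euc d) (fun a : 𝒢 => B.act p a) :=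
  (B.contMDiff_act_left p).mdifferentiable (by simp)

theorem mdifferentiable_act_right (a : 𝒢) :
    MDifferentiable 𝓘(ℝ, Euc d) 𝓘(ℝ, Euc d) (fun p : P => B.act p a) :=
  (B.contMDiff_act_right a).mdifferentiable (by simp)

theorem isOpen_preimage {U : Set M} (hU : IsOpen U) : IsOpen (B.proj ⁻¹' U) :=
  hU.preimage B.proj_smooth.continuous

theorem act_mem {U : Set M} {p : P} (hp : p ∈ B.proj ⁻¹' U) (a : 𝒢) :
    B.act p a ∈ B.proj ⁻¹' U := by
  simpa [B.proj_act] using hp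

theorem act_inv_act (p : P) (a : 𝒢) : B.act (B.act p a) a⁻¹ = p := by
  rw [← B.act_mul, mul_inv_cancel, B.act_one]

theorem exists_act_eq {p q : P} (h : B.proj p = B.proj q) : ∃ a, B.act p a = q := by
  obtain ⟨U, s, φ, -, hm, -, -, -, -, h3⟩ := B.locally_trivial (B.proj p)
  refine ⟨(φ p)⁻¹ * φ q, ?_⟩
  have hp := h3 p hm
  have hq := h3 q (by rw [mem_preimage, ← h]; exact hm)
  rw [← h] at hq
  calc B.act p ((φ p)⁻¹ * φ q) = B.act (B.act (s (B.proj p)) (φ p)) ((φ p)⁻¹ * φ q) := by rw [hp]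
    _ = q := by rw [← B.act_mul, mul_inv_cancel_left, hq]

/-- The local section translated by `φ p` passes through `p`, and the projection is a left inverse
of it. -/
theorem dproj_surjective (p : P) : Function.Surjective (B.dproj p) := by
  obtain ⟨U, s, φ, hU, hm, hs, -, h1, -, h3⟩ := B.locally_trivial (B.proj p)
  intro v
  have hs' : MDifferentiableAt 𝓘(ℝ, Euc n) 𝓘(ℝ, Euc d) s (B.proj p) :=
    ((hs _ hm).contMDiffAt (hU.mem_nhds hm)).mdifferentiableAt (by simp)
  refine ⟨mfderiv 𝓘(ℝ, Euc n) 𝓘(ℝ, Euc d) (fun x => B.act (s x) (φ p)) (B.proj p) v, ?_⟩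
  refine mfderiv_leftInverse (f := fun x => B.act (s x) (φ p)) (h3 p hm)
    (MDifferentiableAt.comp _ (B.mdifferentiable_act_right (φ p) _) hs')
    (B.mdifferentiable_proj p) ?_ v
  filter_upwards [hU.mem_nhds hm] with x hx
  rw [B.proj_act, (h1 x hx).1]

/-- The map `q ↦ (φ p)⁻¹ * φ q` is a left inverse of the orbit map `a ↦ p · a`. -/
theorem dorbit_injective (p : P) : Function.Injective (B.dorbit p) := by
  obtain ⟨U, s, φ, hU, hm, -, hφ, -, h2, -⟩ := B.locally_trivial (B.proj p)
  have hφ' : MDifferentiableAt 𝓘(ℝ, Euc d) 𝓘(ℝ, Euc k) φ p :=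
    ((hφ p hm).contMDiffAt ((B.isOpen_preimage hU).mem_nhds hm)).mdifferentiableAt (by simp)
  have hl : MDifferentiableAt 𝓘(ℝ, Euc k) 𝓘(ℝ, Euc k) (fun x : 𝒢 => (φ p)⁻¹ * x) (φ p) :=
    (contMDiff_mul_left (I := 𝓘(ℝ, Euc k)) (n := ∞)).mdifferentiable (by simp) _
  refine Function.LeftInverse.injective
    (g := fun w : Euc d => (mfderiv 𝓘(ℝ, Euc d) 𝓘(ℝ, Euc k) (fun q => (φ p)⁻¹ * φ q) p w : Euc k)) ?_
  intro v
  refine mfderiv_leftInverse (f := fun a : 𝒢 => B.act p a) (B.act_one p)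
    (B.mdifferentiable_act_left p 1) (MDifferentiableAt.comp p hl hφ') ?_ v
  filter_upwards with a
  simp only [Function.comp, h2 p hm, inv_mul_cancel_left]

theorem dproj_dorbit (p : P) (v : Euc k) : B.dproj p (B.dorbit p v) = 0 := by
  have h2 : (fun a : 𝒢 => B.proj (B.act p a)) = fun _ => B.proj p :=
    funext fun a => B.proj_act p a
  refine (mfderiv_comp_apply_eq (B.act_one p) (B.mdifferentiable_act_left p 1)
    (B.mdifferentiable_proj p) v).trans ?_
  rw [h2, mfderiv_const]
  rfl

theorem dproj_transl (a : 𝒢) (p : P) (v : Tan (d := d) p) :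
    (B.dproj (B.act p a) (B.transl a p v) : Euc n) = B.dproj p v := by
  have h1 := mfderiv_comp p (B.mdifferentiable_proj (B.act p a)) (B.mdifferentiable_act_right a p)
  have h2 : B.proj ∘ (fun p => B.act p a) = B.proj := funext fun p => B.proj_act p a
  rw [h2] at h1
  exact (DFunLike.congr_fun h1 v).symm

theorem finrank_ker_dproj (p : P) : Module.finrank ℝ (B.dproj p).ker + n = d := by
  have h := LinearMap.finrank_range_add_finrank_ker (B.dproj p).toLinearMap
  rw [LinearMap.range_eq_top.2 (B.dproj_surjective p), finrank_top, finrank_euclideanSpace_fin,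
    finrank_euclideanSpace_fin] at h
  rw [add_comm]; exact h

/-- A dimension count: the tangent space of the orbit lies in the kernel of the projection, and both
have dimension `k`. -/
theorem exists_dorbit_eq (hd : d = k + n) {p : P} {v : Tan (d := d) p} (hv : B.dproj p v = 0) :
    ∃ ξ, B.dorbit p ξ = v := by
  have h1 : (B.dorbit p).range ≤ (B.dproj p).ker := by
    rintro _ ⟨ξ, rfl⟩
    exact B.dproj_dorbit p ξ
  have h2 : Module.finrank ℝ (B.dorbit p).range = k := by
    rw [LinearMap.finrank_range_of_inj (B.dorbit_injective p)]
    exact finrank_euclideanSpace_fin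
  have h3 := B.finrank_ker_dproj p
  have h4 : (B.dorbit p).range = (B.dproj p).ker :=
    Submodule.eq_of_le_of_finrank_eq h1 (by rw [h2]; omega)
  have : v ∈ (B.dproj p).ker := hv
  rw [← h4] at this
  exact this

/-- Functions on the part of `P` over `U` that are constant along the orbits. -/
def InvariantOn (U : Set M) (f : P → ℝ) : Prop :=
  ∀ p ∈ B.proj ⁻¹' U, ∀ a, f (B.act p a) = f p

variable {B}

/-- A vertical vector is tangent to an orbit, on which `f` is constant. Without differentiability
the derivative is zero by convention. -/
theorem InvariantOn.mfderiv_eq_zero (hd : d = k + n) {U : Set M} {f : P → ℝ}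
    (hf : B.InvariantOn U f) {p : P} (hp : p ∈ B.proj ⁻¹' U) {v : Tan (d := d) p}
    (hv : B.dproj p v = 0) : mfderiv 𝓘(ℝ, Euc d) 𝓘(ℝ, ℝ) f p v = 0 := by
  by_cases hfd : MDifferentiableAt 𝓘(ℝ, Euc d) 𝓘(ℝ, ℝ) f p
  · obtain ⟨ξ, rfl⟩ := B.exists_dorbit_eq hd hv
    have h2 : (fun a : 𝒢 => f (B.act p a)) = fun _ => f p := funext fun a => hf p hp a
    refine (mfderiv_comp_apply_eq (B.act_one p) (B.mdifferentiable_act_left p 1) hfd ξ).trans ?_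
    rw [h2, mfderiv_const]
    rfl
  · rw [mfderiv_zero_of_not_mdifferentiableAt hfd]
    rfl

/-- No regularity of `f` is needed: translations are diffeomorphisms, so differentiability at `p`
and at `p · a` are equivalent, and where it fails both sides are zero. -/
theorem InvariantOn.dirDeriv {U : Set M} (hU : IsOpen U) {f : P → ℝ} (hf : B.InvariantOn U f)
    {X : VField d P}
    (hX : ∀ p ∈ B.proj ⁻¹' U, ∀ a : 𝒢, X (B.act p a) = B.transl a p (X p)) :
    B.InvariantOn U (dirDeriv X f) := by
  intro p hp a
  have key : ∀ q ∈ B.proj ⁻¹' U, ∀ b : 𝒢, f =ᶠ[𝓝 q] f ∘ (fun p => B.act p b) := by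
    intro q hq b
    filter_upwards [(B.isOpen_preimage hU).mem_nhds hq] with z hz using (hf z hz b).symm
  unfold NilFlow.dirDeriv
  rw [hX p hp a]
  by_cases hfd : MDifferentiableAt 𝓘(ℝ, Euc d) 𝓘(ℝ, ℝ) f (B.act p a)
  · have h1 := mfderiv_comp p hfd (B.mdifferentiable_act_right a p)
    rw [← (key p hp a).mfderiv_eq] at h1
    exact (DFunLike.congr_fun h1 (X p)).symm
  · have hfd' : ¬ MDifferentiableAt 𝓘(ℝ, Euc d) 𝓘(ℝ, ℝ) f p := by
      intro h
      apply hfd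
      rw [(key _ (B.act_mem hp a) a⁻¹).mdifferentiableAt_iff]
      refine MDifferentiableAt.comp _ ?_ (B.mdifferentiable_act_right a⁻¹ _)
      rwa [B.act_inv_act]
    rw [mfderiv_zero_of_not_mdifferentiableAt hfd, mfderiv_zero_of_not_mdifferentiableAt hfd']
    rfl

end PrincipalBundle

end

/-! ### Three-forms on three-dimensional spaces, Gram determinants and fundamental fields -/

section

section Alternating

variable {V : Type*} [AddCommGroup V] [Module ℝ V] [TopologicalSpace V]

/-- Pulled back to `ℝ³` along the coefficients of `f`, the form is a multiple of the determinant. -/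
theorem alternating_map_matrix (H : V [⋀^Fin 3]→L[ℝ] ℝ) (f : Fin 3 → V)
    (T : Matrix (Fin 3) (Fin 3) ℝ) :
    H (fun i => ∑ j, T i j • f j) = T.det * H f := by
  have h := AlternatingMap.eq_smul_basis_det (Pi.basisFun ℝ (Fin 3))
    (H.toAlternatingMap.compLinearMap (Fintype.linearCombination ℝ f))
  have h1 := DFunLike.congr_fun h (fun i => T i)
  rw [AlternatingMap.smul_apply, Pi.basisFun_det_apply] at h1
  simp only [AlternatingMap.compLinearMap_apply, Fintype.linearCombination_apply, smul_eq_mul] at h1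
  refine h1.trans ?_
  rw [mul_comm]
  congr 1
  refine congrArg H ?_
  funext i
  simp [Pi.single_apply]

theorem alternating_swap₀₁ (H : V [⋀^Fin 3]→L[ℝ] ℝ) (a b c : V) :
    H ![b, a, c] = - H ![a, b, c] := by
  have h := H.map_swap ![a, b, c] (i := 0) (j := 1) (by decide)
  refine Eq.trans ?_ h
  refine congrArg H ?_
  ext i
  fin_cases i <;> rfl

theorem alternating_swap₁₂ (H : V [⋀^Fin 3]→L[ℝ] ℝ) (a b c : V) :
    H ![a, c, b] = - H ![a, b, c] := by
  have h := H.map_swap ![a, b, c] (i := 1) (j := 2) (by decide)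
  refine Eq.trans ?_ h
  refine congrArg H ?_
  ext i
  fin_cases i <;> rfl

/-- Such a `c` is `c 0 1 2` times the permutation sign; each of the six nonzero choices of `(i, j,
l)` contributes one copy of `det K`. With `K = G⁻¹` this turns the contracted norm into `6 h² / det
G`. -/
theorem sum_antisymmetric (c : Fin 3 → Fin 3 → Fin 3 → ℝ) (h01 : ∀ i j l, c j i l = - c i j l)
    (h12 : ∀ i j l, c i l j = - c i j l) (K : Matrix (Fin 3) (Fin 3) ℝ) :
    ∑ i, ∑ j, ∑ l, ∑ a, ∑ b, ∑ e, K i a * K j b * K l e * c i j l * c a b e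
      = 6 * K.det * c 0 1 2 ^ 2 := by
  have z1 : ∀ i l, c i i l = 0 := fun i l => by linarith [h01 i i l]
  have z2 : ∀ i l, c l i i = 0 := fun i l => by linarith [h12 l i i]
  have z3 : ∀ i l, c i l i = 0 := fun i l => by linarith [h12 i i l, z1 i l]
  have e1 : c 0 2 1 = - c 0 1 2 := h12 0 1 2
  have e2 : c 1 0 2 = - c 0 1 2 := h01 0 1 2
  have e3 : c 1 2 0 = c 0 1 2 := by rw [h12 1 0 2, e2]; ring
  have e4 : c 2 0 1 = c 0 1 2 := by rw [h01 0 2 1, e1]; ring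
  have e5 : c 2 1 0 = - c 0 1 2 := by rw [h12 2 0 1, e4]
  simp only [Fin.sum_univ_three, z1, z2, z3, e1, e2, e3, e4, e5, Matrix.det_fin_three, mul_zero,
    zero_mul, add_zero, zero_add]
  ring

end Alternating

variable {k n d : ℕ} {𝒢 P M : Type*}
  [TopologicalSpace 𝒢] [ChartedSpace (Euc k) 𝒢] [Group 𝒢] [LieGroup 𝓘(ℝ, Euc k) ∞ 𝒢]
  [TopologicalSpace P] [ChartedSpace (Euc d) P] [IsManifold 𝓘(ℝ, Euc d) ∞ P]
  [TopologicalSpace M] [ChartedSpace (Euc n) M] [IsManifold 𝓘(ℝ, Euc n) ∞ M]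

/-- The metric at a point as a bilinear form on the model space. -/
def Metric.form (g : Metric d P) (p : P) : Euc d →L[ℝ] Euc d →L[ℝ] ℝ := g.inner p

theorem Metric.form_sum_sum (g : Metric d P) (p : P) {m : ℕ} (a b : Fin m → ℝ)
    (f : Fin m → Euc d) :
    g.form p (∑ i, a i • f i) (∑ j, b j • f j)
      = ∑ i, ∑ j, a i * b j * g.form p (f i) (f j) := by
  rw [map_sum (g.form p), sum_apply]
  refine Finset.sum_congr rfl fun i _ => ?_
  rw [map_smul, smul_apply, map_sum, smul_eq_mul, Finset.mul_sum]
  refine Finset.sum_congr rfl fun j _ => ?_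
  rw [map_smul, smul_eq_mul, mul_assoc]

theorem Metric.eq_zero_of_form_self (g : Metric d P) {p : P} {v : Euc d}
    (h : g.form p v v = 0) : v = 0 := by
  by_contra hv
  exact (g.pos p v hv).ne' h

/-- A kernel vector `c` of the Gram matrix makes `∑ c_j f_j` orthogonal to every `f_i`, hence to
itself. -/
theorem Metric.gram_det_ne_zero (g : Metric d P) (p : P) {m : ℕ} {f : Fin m → Euc d}
    (hf : LinearIndependent ℝ f) : (Matrix.of fun i j => g.form p (f i) (f j)).det ≠ 0 := by
  intro h
  obtain ⟨c, hc, hc0⟩ := Matrix.exists_mulVec_eq_zero_iff.2 h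
  apply hc
  have h1 : ∑ j, c j • f j = 0 := by
    apply g.eq_zero_of_form_self (p := p)
    have h2 : ∀ i, g.form p (f i) (∑ j, c j • f j) = 0 := by
      intro i
      have := congrFun hc0 i
      simp only [Matrix.mulVec, dotProduct, Matrix.of_apply, Pi.zero_apply] at this
      simp only [map_sum, map_smul, smul_eq_mul]
      rw [← this]
      exact Finset.sum_congr rfl fun j _ => mul_comm _ _
    have h3 : ∀ w : Euc d, (∀ i, g.form p (f i) w = 0) → g.form p (∑ j, c j • f j) w = 0 := by
      intro w hw
      simp [hw]
    exact h3 _ h2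
  exact funext (Fintype.linearIndependent_iff.1 hf c h1)

namespace PrincipalBundle

variable (B : PrincipalBundle k n d 𝒢 P M)

/-- The fundamental vectors as elements of the model space. -/
def fundVec (p : P) (i : Fin k) : Euc d := B.dorbit p (EuclideanSpace.single i (1 : ℝ))

theorem linearIndependent_fund (p : P) :
    LinearIndependent ℝ (B.fundVec p) := by
  have h1 : LinearIndependent ℝ (fun i : Fin k => (EuclideanSpace.single i (1 : ℝ) : Euc k)) := by
    have := (EuclideanSpace.basisFun (Fin k) ℝ).toBasis.linearIndependent
    simp only [OrthonormalBasis.coe_toBasis] at this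
    convert! this using 1
    ext i : 1
    simp
  exact h1.map' (B.dorbit p).toLinearMap (LinearMap.ker_eq_bot.2 (B.dorbit_injective p))

theorem dproj_fundVec (p : P) (i : Fin k) : B.dproj p (B.fundVec p i) = 0 := B.dproj_dorbit p _

theorem gram_det_ne_zero (g : Metric d P) (p : P) : (B.gram g p).det ≠ 0 :=
  g.gram_det_ne_zero p (B.linearIndependent_fund p)

/-- The fundamental field is the tangent map of the action composed with `p ↦ (0_p, x_i)`, the zero
section paired with a constant vector at `1`. -/
theorem smoothVFieldOn_fund (i : Fin k) : SmoothVFieldOn (fun p => B.fund p i) univ := by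
  let fg : P → TangentBundle 𝓘(ℝ, Euc d) P := fun p => Bundle.TotalSpace.mk' (Euc d) p 0
  have sfg : ContMDiff 𝓘(ℝ, Euc d) 𝓘(ℝ, Euc d).tangent ∞ fg := Bundle.contMDiff_zeroSection _ _
  let fv : P → TangentBundle 𝓘(ℝ, Euc k) 𝒢 := fun _ =>
    Bundle.TotalSpace.mk' (Euc k) (1 : 𝒢) (EuclideanSpace.single i (1 : ℝ) : Euc k)
  have sfv : ContMDiff 𝓘(ℝ, Euc d) 𝓘(ℝ, Euc k).tangent ∞ fv := contMDiff_const
  let F₁ := fun p => (fg p, fv p)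
  have S₁ := sfg.prodMk sfv
  let F₂ := (equivTangentBundleProd 𝓘(ℝ, Euc d) P 𝓘(ℝ, Euc k) 𝒢).symm
  have S₂ : ContMDiff _ _ ∞ F₂ := contMDiff_equivTangentBundleProd_symm
  let F₃ := tangentMap (𝓘(ℝ, Euc d).prod 𝓘(ℝ, Euc k)) 𝓘(ℝ, Euc d)
    (fun x : P × 𝒢 => B.act x.1 x.2)
  have S₃ : ContMDiff _ _ ∞ F₃ := B.act_smooth.contMDiff_tangentMap (m := ∞) (by simp)
  have S := ((S₃.comp S₂).comp S₁)
  intro p _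
  have hS : ((F₃ ∘ F₂) ∘ fun x => (fg x, fv x)) =
      fun p => (⟨p, B.fund p i⟩ : TangentBundle 𝓘(ℝ, Euc d) P) := by
    funext q
    have hb : B.act q 1 = q := B.act_one q
    simp only [Function.comp_apply, tangentMap, F₃, F₂, fg, fv]
    rw [mfderiv_prod_eq_add_apply (B.act_smooth.mdifferentiable (by simp) _)]
    have hcast : ∀ (q' : P) (_ : q' = q) (w : Euc d),
        (⟨q', w⟩ : TangentBundle 𝓘(ℝ, Euc d) P) = ⟨q, w⟩ := by
      rintro _ rfl w
      rfl
    refine (hcast _ hb _).trans (congrArg (Bundle.TotalSpace.mk' (Euc d) q) ?_)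
    let L : Euc d →L[ℝ] Euc d := mfderiv 𝓘(ℝ, Euc d) 𝓘(ℝ, Euc d) (fun z => B.act z 1) q
    change L 0 + B.fundVec q i = B.fundVec q i
    rw [map_zero, zero_add]
  rw [← hS]
  exact S p |>.contMDiffWithinAt

end PrincipalBundle

namespace PrincipalBundle

variable {𝒢 : Type*} [TopologicalSpace 𝒢] [ChartedSpace (Euc 3) 𝒢] [Group 𝒢]
  [LieGroup 𝓘(ℝ, Euc 3) ∞ 𝒢] (B : PrincipalBundle 3 n d 𝒢 P M)

theorem vertNormSqAt_eq (g : Metric d P) (H : ThreeForm d P) (p : P) :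
    B.vertNormSqAt g H p
      = 6 * (B.gram g p).det⁻¹ * H p ![B.fund p 0, B.fund p 1, B.fund p 2] ^ 2 := by
  unfold vertNormSqAt
  rw [sum_antisymmetric (fun i j l => H p ![B.fund p i, B.fund p j, B.fund p l])
    (fun i j l => alternating_swap₀₁ _ _ _ _) (fun i j l => alternating_swap₁₂ _ _ _ _)]
  rw [Matrix.det_nonsing_inv, Ring.inverse_eq_inv']

/-- The norm of the vertical part of a three-form in terms of any basis of the vertical space. -/
theorem vertNormSqAt_eq_of_basis (hd : d = 3 + n) (g : Metric d P) (H : ThreeForm d P) {p : P}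
    {f : Fin 3 → Euc d} (hf : LinearIndependent ℝ f) (hfp : ∀ i, B.dproj p (f i) = 0) :
    B.vertNormSqAt g H p
      = 6 * (Matrix.of fun i j => g.form p (f i) (f j)).det⁻¹ * H p ![f 0, f 1, f 2] ^ 2 := by
  have hfund := B.linearIndependent_fund p
  have hspan : ∀ i, ∃ c : Fin 3 → ℝ, ∑ j, c j • B.fundVec p j = f i := by
    intro i
    obtain ⟨ξ, hξ⟩ := B.exists_dorbit_eq hd (hfp i)
    refine ⟨ξ, ?_⟩
    rw [← hξ]
    have : ξ = ∑ j, ξ j • (EuclideanSpace.single j (1 : ℝ) : Euc 3) := by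
      ext i
      simp [Pi.single_apply]
    conv_rhs => rw [this]
    rw [map_sum]
    refine Finset.sum_congr rfl fun j _ => ?_
    rw [map_smul]
    rfl
  choose c hc using hspan
  let T : Matrix (Fin 3) (Fin 3) ℝ := Matrix.of c
  have hT : ∀ i, f i = ∑ j, T i j • B.fundVec p j := fun i => (hc i).symm
  -- Under the change of basis `T` the Gram determinant gains `(det T)²` and the value of `H` gains
  -- `det T`, so the quotient is unchanged.
  have hgram : (Matrix.of fun i j => g.form p (f i) (f j)) = T * B.gram g p * T.transpose := by
    ext i j
    rw [Matrix.of_apply, hT i, hT j, g.form_sum_sum]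
    simp only [Matrix.mul_apply, Matrix.transpose_apply, Finset.sum_mul]
    rw [Finset.sum_comm]
    refine Finset.sum_congr rfl fun a _ => Finset.sum_congr rfl fun b _ => ?_
    have : B.gram g p b a = g.form p (B.fundVec p b) (B.fundVec p a) := rfl
    rw [this]
    ring
  have hH : H p ![f 0, f 1, f 2] = T.det * H p ![B.fund p 0, B.fund p 1, B.fund p 2] := by
    have := alternating_map_matrix (H p) (fun i => B.fund p i) T
    have e1 : (![f 0, f 1, f 2] : Fin 3 → Euc d) = fun i => ∑ j, T i j • B.fundVec p j := by
      ext i : 1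
      fin_cases i <;> exact hT _
    have e2 : (![B.fund p 0, B.fund p 1, B.fund p 2] : Fin 3 → Tan (d := d) p)
        = fun i => B.fund p i := by
      ext i : 1
      fin_cases i <;> rfl
    rw [e2, ← this]
    exact congrArg (H p) e1
  have hTd : T.det ≠ 0 := by
    have := g.gram_det_ne_zero p hf
    rw [hgram, Matrix.det_mul, Matrix.det_mul] at this
    exact fun h => this (by rw [h]; ring)
  rw [B.vertNormSqAt_eq, hH, hgram, Matrix.det_mul, Matrix.det_mul, Matrix.det_transpose]
  have := B.gram_det_ne_zero g p
  field_simp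

end PrincipalBundle

end

/-! ### Descent of the norm to the base; adapted frames and their brackets -/

section

variable {n d : ℕ} {P M : Type*}
  [TopologicalSpace P] [ChartedSpace (Euc d) P] [IsManifold 𝓘(ℝ, Euc d) ∞ P]
  [TopologicalSpace M] [ChartedSpace (Euc n) M] [IsManifold 𝓘(ℝ, Euc n) ∞ M]

namespace PrincipalBundle

section VertNorm

variable {𝒢 : Type*} [TopologicalSpace 𝒢] [ChartedSpace (Euc 3) 𝒢] [Group 𝒢]
  [LieGroup 𝓘(ℝ, Euc 3) ∞ 𝒢] (B : PrincipalBundle 3 n d 𝒢 P M)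

/-- Translation by `a` does not in general carry fundamental vectors to the fundamental vectors of
the same index, but it carries them to some vertical basis at `p · a`, and the norm may be computed
in any such basis. -/
theorem vertNormSqAt_act (hd : d = 3 + n) {g : Metric d P} {H : ThreeForm d P}
    (hg : B.InvariantMetric g) (hH : B.InvariantThreeForm H) (p : P) (a : 𝒢) :
    B.vertNormSqAt g H (B.act p a) = B.vertNormSqAt g H p := by
  let L : Euc d →L[ℝ] Euc d := B.transl a p
  have hL : Function.Injective L := by
    refine Function.LeftInverse.injective (g := fun w : Euc d =>
      (mfderiv 𝓘(ℝ, Euc d) 𝓘(ℝ, Euc d) (fun q => B.act q a⁻¹) (B.act p a) w : Euc d)) ?_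
    intro v
    refine mfderiv_leftInverse (f := fun q => B.act q a) rfl
      (B.mdifferentiable_act_right a p) (B.mdifferentiable_act_right a⁻¹ _) ?_ v
    filter_upwards with q using B.act_inv_act q a
  rw [B.vertNormSqAt_eq_of_basis hd g H (f := fun i => L (B.fundVec p i))
    ((B.linearIndependent_fund p).map' L.toLinearMap (LinearMap.ker_eq_bot.2 hL))
    (fun i => (B.dproj_transl a p (B.fundVec p i)).trans (B.dproj_fundVec p i)),
    B.vertNormSqAt_eq]
  have h1 : (Matrix.of fun i j => g.form (B.act p a) (L (B.fundVec p i)) (L (B.fundVec p j)))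
      = B.gram g p := by
    ext i j
    exact hg p a _ _
  have h2 : H (B.act p a) ![L (B.fundVec p 0), L (B.fundVec p 1), L (B.fundVec p 2)]
      = H p ![B.fund p 0, B.fund p 1, B.fund p 2] := by
    rw [← hH p a]
    refine congrArg (H (B.act p a)) ?_
    funext i
    fin_cases i <;> rfl
  rw [h1, h2]

theorem vertNormSq_proj (hd : d = 3 + n) {g : Metric d P} {H : ThreeForm d P}
    (hg : B.InvariantMetric g) (hH : B.InvariantThreeForm H) (p : P) :
    B.vertNormSq g H (B.proj p) = B.vertNormSqAt g H p := by
  obtain ⟨a, ha⟩ := B.exists_act_eq (p := p)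
    (q := Function.surjInv B.proj_surjective (B.proj p))
    (Function.surjInv_eq B.proj_surjective (B.proj p)).symm
  unfold vertNormSq
  rw [← ha, B.vertNormSqAt_act hd hg hH]

theorem contMDiff_vertNormSqAt (g : Metric d P) {H : ThreeForm d P} (hs : SmoothThreeForm H) :
    ContMDiff 𝓘(ℝ, Euc d) 𝓘(ℝ, ℝ) ∞ (B.vertNormSqAt g H) := by
  have hf := fun i => B.smoothVFieldOn_fund i
  have hG : ∀ i j, ContMDiff 𝓘(ℝ, Euc d) 𝓘(ℝ, ℝ) ∞ (fun p => B.gram g p i j) := fun i j =>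
    contMDiffOn_univ.1 (contMDiffOn_inner g (hf i) (hf j))
  have hh : ContMDiff 𝓘(ℝ, Euc d) 𝓘(ℝ, ℝ) ∞
      (fun p => H p ![B.fund p 0, B.fund p 1, B.fund p 2]) :=
    contMDiffOn_univ.1 (hs univ isOpen_univ _ _ _ (hf 0) (hf 1) (hf 2))
  have hdet : ContMDiff 𝓘(ℝ, Euc d) 𝓘(ℝ, ℝ) ∞ (fun p => (B.gram g p).det) := by
    simp only [Matrix.det_fin_three]
    exact ((((((hG 0 0).mul (hG 1 1)).mul (hG 2 2)).sub (((hG 0 0).mul (hG 1 2)).mul (hG 2 1))).sub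
      (((hG 0 1).mul (hG 1 0)).mul (hG 2 2))).add (((hG 0 1).mul (hG 1 2)).mul (hG 2 0))).add
      (((hG 0 2).mul (hG 1 0)).mul (hG 2 1)) |>.sub (((hG 0 2).mul (hG 1 1)).mul (hG 2 0))
  have e : B.vertNormSqAt g H = fun p =>
      6 * (B.gram g p).det⁻¹ * H p ![B.fund p 0, B.fund p 1, B.fund p 2] ^ 2 :=
    funext fun p => B.vertNormSqAt_eq g H p
  rw [e]
  exact (contMDiff_const.mul (hdet.inv₀ fun p => B.gram_det_ne_zero g p)).mul (hh.pow 2)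

theorem contMDiff_vertNormSq (hd : d = 3 + n) {g : Metric d P} {H : ThreeForm d P}
    (hg : B.InvariantMetric g) (hH : B.InvariantThreeForm H) (hs : SmoothThreeForm H) :
    ContMDiff 𝓘(ℝ, Euc n) 𝓘(ℝ, ℝ) ∞ (B.vertNormSq g H) := by
  intro m
  obtain ⟨U, s, φ, hU, hm, hsU, -, h1, -, -⟩ := B.locally_trivial m
  have h2 : ContMDiffAt 𝓘(ℝ, Euc n) 𝓘(ℝ, ℝ) ∞ (B.vertNormSqAt g H ∘ s) m :=
    (B.contMDiff_vertNormSqAt g hs _).comp m ((hsU m hm).contMDiffAt (hU.mem_nhds hm))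
  refine h2.congr_of_eventuallyEq ?_
  filter_upwards [hU.mem_nhds hm] with x hx
  rw [Function.comp_apply, ← B.vertNormSq_proj hd hg hH, (h1 x hx).1]

end VertNorm

end PrincipalBundle

variable {k : ℕ} {𝒢 : Type*}
  [TopologicalSpace 𝒢] [ChartedSpace (Euc k) 𝒢] [Group 𝒢] [LieGroup 𝓘(ℝ, Euc k) ∞ 𝒢]

namespace Frame

variable {B : PrincipalBundle k n d 𝒢 P M} {gbar : Metric d P} {U : Set M} (E : Frame B gbar U)

/-- The vectors of a frame as elements of the model space. -/
def vec (x : Fin k ⊕ Fin n) (p : P) : Euc d := E.e x p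

theorem form_vec (x y : Fin k ⊕ Fin n) {p : P} (hp : p ∈ B.proj ⁻¹' U) :
    gbar.form p (E.vec x p) (E.vec y p) = if x = y then 1 else 0 :=
  E.orthonormal x y p hp

theorem dproj_vec_inl (i : Fin k) {p : P} (hp : p ∈ B.proj ⁻¹' U) :
    B.dproj p (E.vec (Sum.inl i) p) = 0 :=
  E.vertical i p hp

theorem form_sum_vec {ι : Type*} [Fintype ι] (f : ι → Fin k ⊕ Fin n) (hf : Function.Injective f)
    (c : ι → ℝ) (j : ι) {p : P} (hp : p ∈ B.proj ⁻¹' U) :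
    gbar.form p (∑ i, c i • E.vec (f i) p) (E.vec (f j) p) = c j := by
  classical
  rw [map_sum (gbar.form p), sum_apply, Finset.sum_eq_single j]
  · rw [map_smul, smul_apply, E.form_vec _ _ hp]
    simp
  · intro i _ hi
    rw [map_smul, smul_apply, E.form_vec _ _ hp, if_neg (fun h => hi (hf h))]
    simp
  · simp

theorem linearIndependent_vec {ι : Type*} [Fintype ι] (f : ι → Fin k ⊕ Fin n)
    (hf : Function.Injective f) {p : P} (hp : p ∈ B.proj ⁻¹' U) :
    LinearIndependent ℝ (fun i => E.vec (f i) p) := by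
  rw [Fintype.linearIndependent_iff]
  intro c hc j
  rw [← E.form_sum_vec f hf c j hp, hc]
  simp

theorem eq_sum_vec (hd : d = k + n) (v : Euc d) {p : P} (hp : p ∈ B.proj ⁻¹' U) :
    v = ∑ x, gbar.form p v (E.vec x p) • E.vec x p := by
  have hli := E.linearIndependent_vec id Function.injective_id hp
  have hspan := hli.span_eq_top_of_card_eq_finrank'
    (by rw [finrank_euclideanSpace_fin, Fintype.card_sum, Fintype.card_fin, Fintype.card_fin, hd])
  have hv : v ∈ Submodule.span ℝ (range fun x => E.vec (id x) p) := by rw [hspan]; trivial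
  obtain ⟨c, hc⟩ := (Submodule.mem_span_range_iff_exists_fun ℝ).1 hv
  rw [← hc]
  refine Finset.sum_congr rfl fun x _ => ?_
  have := E.form_sum_vec id Function.injective_id c x hp
  exact congrArg (· • E.vec x p) this.symm

theorem eq_sum_vec_inl (hd : d = k + n) {p : P} (hp : p ∈ B.proj ⁻¹' U) {v : Euc d}
    (hv : B.dproj p v = 0) :
    v = ∑ i, gbar.form p v (E.vec (Sum.inl i) p) • E.vec (Sum.inl i) p := by
  have hli : LinearIndependent ℝ (fun i => (⟨E.vec (Sum.inl i) p, E.dproj_vec_inl i hp⟩ :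
      (B.dproj p).ker)) :=
    LinearIndependent.of_comp (B.dproj p).ker.subtype
      (E.linearIndependent_vec Sum.inl Sum.inl_injective hp)
  have hspan := hli.span_eq_top_of_card_eq_finrank'
    (by have := B.finrank_ker_dproj p; rw [Fintype.card_fin]; omega)
  have hv : (⟨v, hv⟩ : (B.dproj p).ker) ∈ Submodule.span ℝ (range
      (fun i => (⟨E.vec (Sum.inl i) p, E.dproj_vec_inl i hp⟩ : (B.dproj p).ker))) := by
    rw [hspan]; trivial
  obtain ⟨c, hc⟩ := (Submodule.mem_span_range_iff_exists_fun ℝ).1 hv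
  have hc' : ∑ i, c i • E.vec (Sum.inl i) p = v := by
    simpa using congrArg (B.dproj p).ker.subtype hc
  rw [← hc']
  refine Finset.sum_congr rfl fun x _ => ?_
  rw [E.form_sum_vec Sum.inl Sum.inl_injective c x hp]

theorem form_vec_inr (hd : d = k + n) {p : P} (hp : p ∈ B.proj ⁻¹' U) {v : Euc d}
    (hv : B.dproj p v = 0) (α : Fin n) : gbar.form p v (E.vec (Sum.inr α) p) = 0 := by
  rw [E.eq_sum_vec_inl hd hp hv, map_sum (gbar.form p), sum_apply]
  refine Finset.sum_eq_zero fun i _ => ?_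
  rw [map_smul, smul_apply, E.form_vec _ _ hp]
  simp

/-! Brackets of the frame fields -/

theorem smoothVFieldOn_bracket (hU : IsOpen U) (x y : Fin k ⊕ Fin n) :
    SmoothVFieldOn (bracket (E.e x) (E.e y)) (B.proj ⁻¹' U) :=
  (E.smooth x).bracket (E.smooth y) (B.isOpen_preimage hU)

theorem mdifferentiableAt_e (hU : IsOpen U) (x : Fin k ⊕ Fin n) {p : P} (hp : p ∈ B.proj ⁻¹' U) :
    MDifferentiableAt 𝓘(ℝ, Euc d) 𝓘(ℝ, Euc d).tangent
      (fun q => (⟨q, E.e x q⟩ : TangentBundle 𝓘(ℝ, Euc d) P)) p :=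
  (E.smooth x).mdifferentiableAt (B.isOpen_preimage hU) hp

/-- An invariant field is related to itself by every translation. -/
theorem bracket_act (hU : IsOpen U) (x y : Fin k ⊕ Fin n) {p : P} (hp : p ∈ B.proj ⁻¹' U) (a : 𝒢) :
    bracket (E.e x) (E.e y) (B.act p a) = B.transl a p (bracket (E.e x) (E.e y) p) := by
  have h : ∀ x, ∀ᶠ q in 𝓝 p, mfderiv 𝓘(ℝ, Euc d) 𝓘(ℝ, Euc d) (fun q => B.act q a) q (E.e x q)
      = E.e x (B.act q a) := by
    intro x
    filter_upwards [(B.isOpen_preimage hU).mem_nhds hp] with q hq using (E.invariant x q hq a).symm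
  exact (mfderiv_mlieBracket_of_related (B.contMDiff_act_right a p)
    (E.mdifferentiableAt_e hU x hp) (E.mdifferentiableAt_e hU y hp)
    (E.mdifferentiableAt_e hU x (B.act_mem hp a)) (E.mdifferentiableAt_e hU y (B.act_mem hp a))
    (h x) (h y)).symm

/-- Each frame field is locally related to a vector field on the base. -/
theorem exists_related (hU : IsOpen U) (x : Fin k ⊕ Fin n) {p : P} (hp : p ∈ B.proj ⁻¹' U) :
    ∃ X : ∀ m : M, TangentSpace 𝓘(ℝ, Euc n) m,
      MDifferentiableAt 𝓘(ℝ, Euc n) 𝓘(ℝ, Euc n).tangent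
        (fun m => (⟨m, X m⟩ : TangentBundle 𝓘(ℝ, Euc n) M)) (B.proj p) ∧
      ∀ᶠ q in 𝓝 p, mfderiv 𝓘(ℝ, Euc d) 𝓘(ℝ, Euc n) B.proj q (E.e x q) = X (B.proj q) := by
  obtain ⟨V, s, φ, hV, hm, hs, -, h1, -, -⟩ := B.locally_trivial (B.proj p)
  have hcast : ∀ (m m' : M) (_ : m' = m) (w : Euc n),
      (⟨m', w⟩ : TangentBundle 𝓘(ℝ, Euc n) M) = ⟨m, w⟩ := by
    rintro m _ rfl w
    rfl
  -- The base field is the projection of the frame field along a local section; by invariance the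
  -- projection is the same at every other point of the fibre.
  refine ⟨fun m => (B.dproj (s m) (E.vec x (s m)) : Euc n), ?_, ?_⟩
  · have hsp : s (B.proj p) ∈ B.proj ⁻¹' U := by
      rw [mem_preimage, (h1 _ hm).1]; exact hp
    have hs' : MDifferentiableAt 𝓘(ℝ, Euc n) 𝓘(ℝ, Euc d) s (B.proj p) :=
      ((hs _ hm).contMDiffAt (hV.mem_nhds hm)).mdifferentiableAt (by simp)
    have h2 := (E.mdifferentiableAt_e hU x hsp).comp (B.proj p) hs'
    have h3 : MDifferentiable 𝓘(ℝ, Euc d).tangent 𝓘(ℝ, Euc n).tangent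
        (tangentMap 𝓘(ℝ, Euc d) 𝓘(ℝ, Euc n) B.proj) :=
      (B.proj_smooth.contMDiff_tangentMap (m := ∞) (by simp)).mdifferentiable (by simp)
    refine ((h3 _).comp (B.proj p) h2).congr_of_eventuallyEq ?_
    filter_upwards [hV.mem_nhds hm] with m hmV
    exact (hcast m (B.proj (s m)) (h1 m hmV).1 _).symm
  · filter_upwards [(B.isOpen_preimage hV).mem_nhds hm, (B.isOpen_preimage hU).mem_nhds hp]
      with q hq hqU
    have hsq : s (B.proj q) ∈ B.proj ⁻¹' U := by
      rw [mem_preimage, (h1 _ hq).1]; exact hqU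
    obtain ⟨a, ha⟩ := B.exists_act_eq (p := s (B.proj q)) (q := q) (h1 _ hq).1
    have h4 := E.invariant x _ hsq a
    have h5 := B.dproj_transl a (s (B.proj q)) (E.e x (s (B.proj q)))
    rw [← h4] at h5
    rw [ha] at h5
    exact h5

/-- A vertical field is related to the zero field on the base, so its bracket with a projectable
field projects to `[X, 0] = 0`. -/
theorem dproj_bracket (hU : IsOpen U) (x : Fin k ⊕ Fin n) (j : Fin k) {p : P} (hp : p ∈ B.proj ⁻¹' U) :
    B.dproj p (bracket (E.e x) (E.e (Sum.inl j)) p) = 0 := by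
  obtain ⟨X, hX, hrel⟩ := E.exists_related hU x hp
  have h0 : MDifferentiableAt 𝓘(ℝ, Euc n) 𝓘(ℝ, Euc n).tangent
      (fun m => (⟨m, (0 : ∀ m : M, TangentSpace 𝓘(ℝ, Euc n) m) m⟩ : TangentBundle 𝓘(ℝ, Euc n) M))
      (B.proj p) :=
    (Bundle.contMDiff_zeroSection (n := ∞) ℝ
      (fun m : M => TangentSpace 𝓘(ℝ, Euc n) m)).mdifferentiable (by simp) _
  have h := mfderiv_mlieBracket_of_related (B.proj_smooth p)
    (E.mdifferentiableAt_e hU x hp) (E.mdifferentiableAt_e hU (Sum.inl j) hp) hX h0 hrel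
    (by filter_upwards [(B.isOpen_preimage hU).mem_nhds hp] with q hq using E.vertical j q hq)
  refine h.trans ?_
  rw [mlieBracket_zero_right]
  rfl

end Frame

end

/-! ### Unimodularity of the fibres -/

section

variable {k n d : ℕ} {𝒢 P M : Type*}
  [TopologicalSpace 𝒢] [ChartedSpace (Euc k) 𝒢] [Group 𝒢] [LieGroup 𝓘(ℝ, Euc k) ∞ 𝒢]
  [TopologicalSpace P] [ChartedSpace (Euc d) P] [IsManifold 𝓘(ℝ, Euc d) ∞ P]
  [TopologicalSpace M] [ChartedSpace (Euc n) M] [IsManifold 𝓘(ℝ, Euc n) ∞ M]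

/-- Nilpotent Lie algebras are unimodular. -/
theorem trace_ad_eq_zero {L : Type*} [LieRing L] [LieAlgebra ℝ L] [FiniteDimensional ℝ L]
    (h : LieRing.IsNilpotent L) (x : L) : LinearMap.trace ℝ L (LieAlgebra.ad ℝ L x) = 0 := by
  obtain ⟨m, hm⟩ := LieAlgebra.nilpotent_ad_of_nilpotent_algebra ℝ L
  exact (LinearMap.isNilpotent_trace_of_isNilpotent ⟨m, hm x⟩).eq_zero

namespace Frame

variable {B : PrincipalBundle k n d 𝒢 P M} {gbar : Metric d P} {U : Set M} (E : Frame B gbar U)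

/-- The brackets of the frame fields as elements of the model space. -/
def brk (x y : Fin k ⊕ Fin n) (p : P) : Euc d := bracket (E.e x) (E.e y) p

theorem C_eq_form (x y z : Fin k ⊕ Fin n) (p : P) :
    E.C x y z p = gbar.form p (E.brk x y p) (E.vec z p) := rfl

theorem brk_antisymm (x y : Fin k ⊕ Fin n) (p : P) : E.brk y x p = - E.brk x y p :=
  mlieBracket_swap_apply

theorem C_antisymm (x y z : Fin k ⊕ Fin n) (p : P) : E.C y x z p = - E.C x y z p := by
  rw [C_eq_form, brk_antisymm, map_neg (gbar.form p), neg_apply, C_eq_form]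

/-- The vertical frame fields, restricted to the orbit of `p`, correspond to left-invariant fields
on `𝒢`. Hence their structure functions at `p` are the structure constants of the Lie algebra in
some basis, and the sum is the trace of an `ad`. -/
theorem sum_C_inl (h𝒢 : NilpotentLieGroup k 𝒢) (hd : d = k + n) (hU : IsOpen U)
    (i : Fin k) {p : P} (hp : p ∈ B.proj ⁻¹' U) :
    ∑ j, E.C (Sum.inl i) (Sum.inl j) (Sum.inl j) p = 0 := by
  -- The inverse is essential: `f (a * b) = f b · a⁻¹`, so left multiplication on `𝒢` becomes a
  -- right translation on `P`, under which the frame is invariant.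
  let f : 𝒢 → P := fun a => B.act p a⁻¹
  have hf1 : f 1 = p := by simp only [f, inv_one, B.act_one]
  have hinv : ContMDiff 𝓘(ℝ, Euc k) 𝓘(ℝ, Euc k) ∞ (fun a : 𝒢 => a⁻¹) := contMDiff_inv _ _
  have hf : ContMDiff 𝓘(ℝ, Euc k) 𝓘(ℝ, Euc d) ∞ f := (B.contMDiff_act_left p).comp hinv
  have hfd : MDifferentiable 𝓘(ℝ, Euc k) 𝓘(ℝ, Euc d) f := hf.mdifferentiable (by simp)
  let L : Euc k →L[ℝ] Euc d := mfderiv 𝓘(ℝ, Euc k) 𝓘(ℝ, Euc d) f 1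
  have hsurj : ∀ i, ∃ ξ, L ξ = E.vec (Sum.inl i) p := by
    intro i
    obtain ⟨ξ, hξ⟩ := B.exists_dorbit_eq hd (E.dproj_vec_inl i hp)
    refine ⟨mfderiv 𝓘(ℝ, Euc k) 𝓘(ℝ, Euc k) (fun a : 𝒢 => a⁻¹) 1 ξ, ?_⟩
    have := mfderiv_comp_apply_eq (inv_one (G := 𝒢)) (hinv.mdifferentiable (by simp) 1) (hfd 1) ξ
    refine this.trans ?_
    have e : (fun a : 𝒢 => f a⁻¹) = fun a => B.act p a := by
      funext a
      simp only [f, inv_inv]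
    rw [e]
    exact hξ
  choose ξ hξ using hsurj
  have hrel : ∀ i, ∀ᶠ a in 𝓝 (1 : 𝒢), mfderiv 𝓘(ℝ, Euc k) 𝓘(ℝ, Euc d) f a
      (mulInvariantVectorField (I := 𝓘(ℝ, Euc k)) (ξ i) a) = E.e (Sum.inl i) (f a) := by
    intro i
    filter_upwards with a
    have hl : MDifferentiableAt 𝓘(ℝ, Euc k) 𝓘(ℝ, Euc k) (fun x : 𝒢 => a * x) 1 :=
      (contMDiff_mul_left (I := 𝓘(ℝ, Euc k)) (n := ∞)).mdifferentiable (by simp) _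
    refine (mfderiv_comp_apply_eq (mul_one a) hl (hfd a) (ξ i)).trans ?_
    have e : (fun b => f (a * b)) = fun b => B.act (f b) a⁻¹ := by
      funext b
      simp only [f, mul_inv_rev, B.act_mul]
    rw [e]
    refine (mfderiv_comp_apply_eq hf1 (hfd 1) (B.mdifferentiable_act_right a⁻¹ p) (ξ i)).symm.trans ?_
    refine Eq.trans ?_ (E.invariant (Sum.inl i) p hp a⁻¹).symm
    exact congrArg (B.transl a⁻¹ p) (hξ i)
  let ξ' : Fin k → GroupLieAlgebra 𝓘(ℝ, Euc k) 𝒢 := ξ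
  let L' : GroupLieAlgebra 𝓘(ℝ, Euc k) 𝒢 →ₗ[ℝ] Euc d := L.toLinearMap
  have hfin : FiniteDimensional ℝ (GroupLieAlgebra 𝓘(ℝ, Euc k) 𝒢) :=
    inferInstanceAs (FiniteDimensional ℝ (Euc k))
  have hrank : Module.finrank ℝ (GroupLieAlgebra 𝓘(ℝ, Euc k) 𝒢) = k :=
    (finrank_euclideanSpace_fin : Module.finrank ℝ (Euc k) = k)
  have hli : LinearIndependent ℝ ξ' := by
    apply LinearIndependent.of_comp L'
    have : L' ∘ ξ' = fun i => E.vec (Sum.inl i) p := funext hξ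
    rw [this]
    exact E.linearIndependent_vec Sum.inl Sum.inl_injective hp
  have hbr : ∀ i j, L' ⁅ξ' i, ξ' j⁆ = E.brk (Sum.inl i) (Sum.inl j) p := by
    intro i j
    have hp1 : f 1 ∈ B.proj ⁻¹' U := by rw [hf1]; exact hp
    have := mfderiv_mlieBracket_of_related (hf 1)
      (mdifferentiableAt_mulInvariantVectorField (I := 𝓘(ℝ, Euc k)) (ξ' i))
      (mdifferentiableAt_mulInvariantVectorField (I := 𝓘(ℝ, Euc k)) (ξ' j))
      (E.mdifferentiableAt_e hU _ hp1) (E.mdifferentiableAt_e hU _ hp1) (hrel i) (hrel j)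
    rw [hf1] at this
    exact this
  have : Nonempty (Fin k) := ⟨i⟩
  let b := basisOfLinearIndependentOfCardEqFinrank hli (by rw [hrank, Fintype.card_fin])
  have hb : ∀ i, b i = ξ' i := fun i => by simp [b]
  have htr := trace_ad_eq_zero h𝒢 (ξ' i)
  rw [LinearMap.trace_eq_matrix_trace ℝ b, Matrix.trace] at htr
  rw [← htr]
  refine Finset.sum_congr rfl fun j _ => ?_
  rw [Matrix.diag_apply, LinearMap.toMatrix_apply, hb, LieAlgebra.ad_apply]
  have h1 := congrArg L' (b.sum_repr ⁅ξ' i, ξ' j⁆)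
  rw [hbr, map_sum] at h1
  have h2 : ∀ l, L' (b.repr ⁅ξ' i, ξ' j⁆ l • b l)
      = b.repr ⁅ξ' i, ξ' j⁆ l • E.vec (Sum.inl l) p := by
    intro l
    rw [map_smul, hb]
    exact congrArg _ (hξ l)
  rw [Finset.sum_congr rfl fun l _ => h2 l] at h1
  rw [C_eq_form, ← h1, E.form_sum_vec Sum.inl Sum.inl_injective _ j hp]

end Frame

end

/-! ### Components in a frame: regularity, symmetry, invariance, expansions -/

section

variable {k n d : ℕ} {𝒢 P M : Type*}
  [TopologicalSpace 𝒢] [ChartedSpace (Euc k) 𝒢] [Group 𝒢] [LieGroup 𝓘(ℝ, Euc k) ∞ 𝒢]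
  [TopologicalSpace P] [ChartedSpace (Euc d) P] [IsManifold 𝓘(ℝ, Euc d) ∞ P]
  [TopologicalSpace M] [ChartedSpace (Euc n) M] [IsManifold 𝓘(ℝ, Euc n) ∞ M]

namespace Frame

variable {B : PrincipalBundle k n d 𝒢 P M} {gbar : Metric d P} {U : Set M} (E : Frame B gbar U)
  {H : ThreeForm d P}

/-! Regularity of the components -/

theorem contMDiffOn_C (hU : IsOpen U) (x y z : Fin k ⊕ Fin n) :
    ContMDiffOn 𝓘(ℝ, Euc d) 𝓘(ℝ, ℝ) ∞ (E.C x y z) (B.proj ⁻¹' U) :=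
  contMDiffOn_inner gbar (E.smoothVFieldOn_bracket hU x y) (E.smooth z)

theorem mdifferentiableAt_C (hU : IsOpen U) (x y z : Fin k ⊕ Fin n) {p : P}
    (hp : p ∈ B.proj ⁻¹' U) : MDifferentiableAt 𝓘(ℝ, Euc d) 𝓘(ℝ, ℝ) (E.C x y z) p :=
  ((E.contMDiffOn_C hU x y z p hp).contMDiffAt
    ((B.isOpen_preimage hU).mem_nhds hp)).mdifferentiableAt (by simp)

theorem mdifferentiableAt_Hc (hU : IsOpen U) (hs : SmoothThreeForm H) (x y z : Fin k ⊕ Fin n)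
    {p : P} (hp : p ∈ B.proj ⁻¹' U) :
    MDifferentiableAt 𝓘(ℝ, Euc d) 𝓘(ℝ, ℝ) (E.Hc H x y z) p :=
  ((hs _ (B.isOpen_preimage hU) _ _ _ (E.smooth x) (E.smooth y) (E.smooth z) p hp).contMDiffAt
    ((B.isOpen_preimage hU).mem_nhds hp)).mdifferentiableAt (by simp)

/-! Symmetries of the components -/

theorem Hc_swap₀₁ (x y z : Fin k ⊕ Fin n) (p : P) : E.Hc H y x z p = - E.Hc H x y z p :=
  alternating_swap₀₁ _ _ _ _

theorem Hc_swap₁₂ (x y z : Fin k ⊕ Fin n) (p : P) : E.Hc H x z y p = - E.Hc H x y z p :=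
  alternating_swap₁₂ _ _ _ _

theorem Hc_self₀₁ (x z : Fin k ⊕ Fin n) (p : P) : E.Hc H x x z p = 0 := by
  linarith [E.Hc_swap₀₁ (H := H) x x z p]

theorem Hc_self₁₂ (x z : Fin k ⊕ Fin n) (p : P) : E.Hc H z x x p = 0 := by
  linarith [E.Hc_swap₁₂ (H := H) z x x p]

theorem Hc_self₀₂ (x z : Fin k ⊕ Fin n) (p : P) : E.Hc H x z x p = 0 := by
  linarith [E.Hc_swap₁₂ (H := H) x x z p, E.Hc_self₀₁ (H := H) x z p]

theorem C_self (x z : Fin k ⊕ Fin n) (p : P) : E.C x x z p = 0 := by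
  linarith [E.C_antisymm x x z p]

/-- The bracket is vertical, hence orthogonal to the horizontal frame fields. -/
theorem C_inl_inr (hd : d = k + n) (hU : IsOpen U) (x : Fin k ⊕ Fin n) (j : Fin k) (α : Fin n)
    {p : P} (hp : p ∈ B.proj ⁻¹' U) : E.C x (Sum.inl j) (Sum.inr α) p = 0 :=
  E.form_vec_inr hd hp (E.dproj_bracket hU x j hp) α

/-- In an orthonormal frame `G(η_i, η_j)` is constant, so only the bracket terms of `DG` survive. -/
theorem DG_eq (hU : IsOpen U) (α : Fin n) (i j : Fin k) {p : P} (hp : p ∈ B.proj ⁻¹' U) :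
    E.DG α i j p = - (E.C (Sum.inr α) (Sum.inl i) (Sum.inl j) p
      + E.C (Sum.inr α) (Sum.inl j) (Sum.inl i) p) := by
  have h1 : (fun q => gbar.inner q (E.η i q) (E.η j q))
      =ᶠ[𝓝 p] fun _ => if (Sum.inl i : Fin k ⊕ Fin n) = Sum.inl j then 1 else 0 := by
    filter_upwards [(B.isOpen_preimage hU).mem_nhds hp] with q hq using E.orthonormal _ _ q hq
  have h2 : gbar.inner p (E.η i p) (bracket (E.v α) (E.η j) p)
      = E.C (Sum.inr α) (Sum.inl j) (Sum.inl i) p := gbar.symm p _ _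
  unfold DG
  rw [dirDeriv_congr h1, dirDeriv_const, h2]
  have h3 : gbar.inner p (bracket (E.v α) (E.η i) p) (E.η j p)
      = E.C (Sum.inr α) (Sum.inl i) (Sum.inl j) p := rfl
  rw [h3]
  ring

theorem DH_swap₁₂ (hU : IsOpen U) (hs : SmoothThreeForm H) (α : Fin n) (x y z : Fin k ⊕ Fin n)
    {p : P} (hp : p ∈ B.proj ⁻¹' U) : E.DH H α x z y p = - E.DH H α x y z p := by
  have h1 : dirDeriv (E.v α) (E.Hc H x z y) p = - dirDeriv (E.v α) (E.Hc H x y z) p := by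
    rw [dirDeriv_congr (g := fun q => (-1) * E.Hc H x y z q)
      (Eventually.of_forall fun q => by rw [E.Hc_swap₁₂]; ring),
      dirDeriv_const_mul _ (E.mdifferentiableAt_Hc hU hs x y z hp)]
    ring
  have h2 : ∑ w, (E.conn α x w p * E.Hc H w z y p + E.conn α z w p * E.Hc H x w y p
      + E.conn α y w p * E.Hc H x z w p)
      = - ∑ w, (E.conn α x w p * E.Hc H w y z p + E.conn α y w p * E.Hc H x w z p
      + E.conn α z w p * E.Hc H x y w p) := by
    rw [← Finset.sum_neg_distrib]
    refine Finset.sum_congr rfl fun w _ => ?_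
    rw [E.Hc_swap₁₂ w y z, E.Hc_swap₁₂ x y w, E.Hc_swap₁₂ x w z]
    ring
  unfold DH
  rw [h1, h2]
  ring

theorem Bc_antisymm (hU : IsOpen U) (hs : SmoothThreeForm H) (x y : Fin k ⊕ Fin n)
    {p : P} (hp : p ∈ B.proj ⁻¹' U) : E.Bc H y x p = - E.Bc H x y p := by
  have hw : ∀ (a : Fin k → ℝ) (b : Fin k ⊕ Fin n → ℝ), wedge a b y x = - wedge a b x y := by
    intro a b
    unfold wedge
    ring
  unfold Bc
  simp only [hw, E.DH_swap₁₂ hU hs _ _ x y hp, Finset.sum_neg_distrib]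
  ring

/-! Invariance of the components -/

theorem invariantOn_C (hg : B.InvariantMetric gbar) (hU : IsOpen U) (x y z : Fin k ⊕ Fin n) :
    B.InvariantOn U (E.C x y z) := by
  intro p hp a
  unfold C
  rw [E.bracket_act hU x y hp a, E.invariant z p hp a, hg]

theorem invariantOn_Hc (hH : B.InvariantThreeForm H) (x y z : Fin k ⊕ Fin n) :
    B.InvariantOn U (E.Hc H x y z) := by
  intro p hp a
  unfold Hc evalForm
  rw [E.invariant x p hp a, E.invariant y p hp a, E.invariant z p hp a, ← hH p a]
  refine congrArg (H (B.act p a)) ?_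
  funext i
  fin_cases i <;> rfl

/-- With antisymmetry, this is all that is used about `B`: its vertical derivatives vanish. -/
theorem invariantOn_Bc (hg : B.InvariantMetric gbar) (hH : B.InvariantThreeForm H)
    (hU : IsOpen U) (x y : Fin k ⊕ Fin n) : B.InvariantOn U (E.Bc H x y) := by
  intro p hp a
  have hp' := B.act_mem hp a
  have hC := fun x y z => E.invariantOn_C hg hU x y z p hp a
  have hHc := fun x y z => E.invariantOn_Hc hH x y z p hp a
  have hdH := fun α x y z =>
    (E.invariantOn_Hc hH x y z).dirDeriv hU (X := E.v α) (E.invariant _) p hp a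
  have hconn : ∀ α x y, E.conn α x y (B.act p a) = E.conn α x y p := by
    rintro α (i | β) (j | γ) <;> simp only [conn, Γ, hC]
  simp only [Bc, DH, E.DG_eq hU _ _ _ hp, E.DG_eq hU _ _ _ hp', F, hC, hHc, hdH, hconn]

/-! Expansions in the frame -/

theorem evalForm_bracket (hd : d = k + n) (x y z w : Fin k ⊕ Fin n) {p : P}
    (hp : p ∈ B.proj ⁻¹' U) :
    evalForm H (bracket (E.e x) (E.e y)) (E.e z) (E.e w) p
      = ∑ u, E.C x y u p * E.Hc H u z w p := by
  let Hp : Euc d [⋀^Fin 3]→L[ℝ] ℝ := H p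
  let L : Euc d →ₗ[ℝ] ℝ :=
    Hp.toMultilinearMap.toLinearMap ![0, E.vec z p, E.vec w p] 0
  have hL : ∀ v, L v = Hp ![v, E.vec z p, E.vec w p] := by
    intro v
    refine congrArg Hp ?_
    funext i
    fin_cases i <;> rfl
  have h1 : evalForm H (bracket (E.e x) (E.e y)) (E.e z) (E.e w) p = L (E.brk x y p) := (hL _).symm
  have h2 : ∀ u, E.Hc H u z w p = L (E.vec u p) := fun u => (hL _).symm
  rw [h1, E.eq_sum_vec hd (E.brk x y p) hp, map_sum]
  refine Finset.sum_congr rfl fun u _ => ?_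
  rw [map_smul, h2, smul_eq_mul, C_eq_form]

theorem inner_bracket_self (hd : d = k + n) (hU : IsOpen U) (i j : Fin k) {p : P}
    (hp : p ∈ B.proj ⁻¹' U) :
    gbar.inner p (bracket (E.η i) (E.η j) p) (bracket (E.η i) (E.η j) p)
      = ∑ l, E.C (Sum.inl i) (Sum.inl j) (Sum.inl l) p ^ 2 := by
  change gbar.form p (E.brk (Sum.inl i) (Sum.inl j) p) (E.brk (Sum.inl i) (Sum.inl j) p) = _
  have h := E.eq_sum_vec_inl hd hp (E.dproj_bracket hU (Sum.inl i) j hp)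
  change E.brk (Sum.inl i) (Sum.inl j) p = _ at h
  conv_lhs => enter [2]; rw [h]
  rw [map_sum]
  refine Finset.sum_congr rfl fun l _ => ?_
  rw [map_smul, smul_eq_mul, sq]
  rfl

end Frame

end

/-! ### Three-dimensional fibres over a one-dimensional base -/

section

/-- The derivative of `6 h² / det G` at a time where `G` is the identity matrix. -/
theorem hasDerivWithinAt_norm {J : Set ℝ} {t : ℝ} {G : ℝ → Matrix (Fin 3) (Fin 3) ℝ}
    {r : Fin 3 → Fin 3 → ℝ} {h : ℝ → ℝ} {h' : ℝ}
    (hG : ∀ i j, HasDerivWithinAt (fun s => G s i j) (r i j) J t)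
    (hG1 : ∀ i j, G t i j = if i = j then 1 else 0) (hh : HasDerivWithinAt h h' J t) :
    HasDerivWithinAt (fun s => 6 * (G s).det⁻¹ * h s ^ 2)
      (12 * h t * h' - 6 * h t ^ 2 * ∑ i, r i i) J t := by
  -- At the identity matrix the derivative of the determinant is the trace.
  have hdet : HasDerivWithinAt (fun s => (G s).det) (∑ i, r i i) J t := by
    simp only [Matrix.det_fin_three]
    have := ((((((hG 0 0).mul (hG 1 1)).mul (hG 2 2)).sub (((hG 0 0).mul (hG 1 2)).mul (hG 2 1))).sub
      (((hG 0 1).mul (hG 1 0)).mul (hG 2 2))).add (((hG 0 1).mul (hG 1 2)).mul (hG 2 0))).add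
      (((hG 0 2).mul (hG 1 0)).mul (hG 2 1)) |>.sub (((hG 0 2).mul (hG 1 1)).mul (hG 2 0))
    refine this.congr_deriv ?_
    simp [hG1, Fin.sum_univ_three]
  have h1 : (G t).det = 1 := by
    rw [show G t = 1 from Matrix.ext fun i j => by rw [hG1, Matrix.one_apply], Matrix.det_one]
  have := ((hdet.fun_inv (by rw [h1]; norm_num)).const_mul 6).mul (hh.pow 2)
  refine this.congr_deriv ?_
  rw [h1]
  norm_num
  ring

variable {d : ℕ} {𝒢 P M : Type*}
  [TopologicalSpace 𝒢] [ChartedSpace (Euc 3) 𝒢] [Group 𝒢] [LieGroup 𝓘(ℝ, Euc 3) ∞ 𝒢]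
  [TopologicalSpace P] [ChartedSpace (Euc d) P] [IsManifold 𝓘(ℝ, Euc d) ∞ P]
  [TopologicalSpace M] [ChartedSpace (Euc 1) M] [IsManifold 𝓘(ℝ, Euc 1) ∞ M]

namespace Frame

variable {B : PrincipalBundle 3 1 d 𝒢 P M} {gbar : Metric d P} {U : Set M} (E : Frame B gbar U)
  {H : ThreeForm d P}

/-- The component of `H` on the fibres. -/
def h (H : ThreeForm d P) : P → ℝ := E.Hc H (Sum.inl 0) (Sum.inl 1) (Sum.inl 2)

/-- The trace of `η ↦ [v, η]`. -/
def trD (p : P) : ℝ := ∑ i, E.C (Sum.inr 0) (Sum.inl i) (Sum.inl i) p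

theorem vertNormSqAt_eq_of_frame (hd : d = 3 + 1) (g : Metric d P) (H : ThreeForm d P) {p : P}
    (hp : p ∈ B.proj ⁻¹' U) :
    B.vertNormSqAt g H p = 6 * (Matrix.of fun i j =>
      g.form p (E.vec (Sum.inl i) p) (E.vec (Sum.inl j) p)).det⁻¹ * E.h H p ^ 2 :=
  B.vertNormSqAt_eq_of_basis hd g H (f := fun i => E.vec (Sum.inl i) p)
    (E.linearIndependent_vec Sum.inl Sum.inl_injective hp) fun i => E.dproj_vec_inl i hp

theorem vertNormSq_eq (hd : d = 3 + 1) (hg : B.InvariantMetric gbar)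
    (hH : B.InvariantThreeForm H) {p : P} (hp : p ∈ B.proj ⁻¹' U) :
    B.vertNormSq gbar H (B.proj p) = 6 * E.h H p ^ 2 := by
  rw [B.vertNormSq_proj hd hg hH, E.vertNormSqAt_eq_of_frame hd gbar H hp]
  have : (Matrix.of fun i j => gbar.form p (E.vec (Sum.inl i) p) (E.vec (Sum.inl j) p))
      = (1 : Matrix (Fin 3) (Fin 3) ℝ) := by
    ext i j
    rw [Matrix.of_apply, E.form_vec _ _ hp, Matrix.one_apply]
    simp
  rw [this, Matrix.det_one]
  ring

theorem C_inr_inr (z : Fin 3 ⊕ Fin 1) (α β : Fin 1) (p : P) :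
    E.C (Sum.inr α) (Sum.inr β) z p = 0 := by
  rw [Subsingleton.elim α β, E.C_self]

theorem Γ_eq_zero (α β γ : Fin 1) (p : P) : E.Γ α β γ p = 0 := by
  simp [Γ, C_inr_inr]

theorem F_eq_zero (α β : Fin 1) (i : Fin 3) (p : P) : E.F α β i p = 0 := by
  simp [F, C_inr_inr]

/-- The exterior derivative of an invariant two-form has no fibre component if the fibres are
unimodular. -/
theorem dB_inl (h𝒢 : NilpotentLieGroup 3 𝒢) (hd : d = 3 + 1) (hU : IsOpen U)
    (hg : B.InvariantMetric gbar) (hH : B.InvariantThreeForm H) (hs : SmoothThreeForm H)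
    {p : P} (hp : p ∈ B.proj ⁻¹' U) :
    E.dB H (Sum.inl 0) (Sum.inl 1) (Sum.inl 2) p = 0 := by
  have hz : ∀ i x y, dirDeriv (E.e (Sum.inl i)) (E.Bc H x y) p = 0 := fun i x y =>
    (E.invariantOn_Bc hg hH hU x y).mfderiv_eq_zero hd hp (E.vertical i p hp)
  have hb := fun x y => E.Bc_antisymm hU hs x y hp
  have hb0 : ∀ x, E.Bc H x x p = 0 := fun x => by linarith [hb x x]
  have hc := fun i j l => E.C_antisymm (Sum.inl i) (Sum.inl j) (Sum.inl l) p
  have u0 := E.sum_C_inl h𝒢 hd hU 0 hp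
  have u1 := E.sum_C_inl h𝒢 hd hU 1 hp
  have u2 := E.sum_C_inl h𝒢 hd hU 2 hp
  simp only [Fin.sum_univ_three, E.C_self] at u0 u1 u2
  rw [hc 0 1 0] at u1
  rw [hc 0 2 0, hc 1 2 1] at u2
  simp only [dB, hz, Fintype.sum_sum_type, Fin.sum_univ_three, Fin.sum_univ_one,
    E.C_inl_inr hd hU _ _ _ hp, hb0, hb (Sum.inl 0) (Sum.inl 1), hb (Sum.inl 0) (Sum.inl 2),
    hb (Sum.inl 1) (Sum.inl 2)]
  -- Up to sign, each `B(η_j, η_l)` is multiplied by the trace of `ad` of the remaining frame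
  -- vector.
  linear_combination (-E.Bc H (Sum.inl 1) (Sum.inl 2) p) * u0
    + (E.Bc H (Sum.inl 0) (Sum.inl 2) p) * u1 - (E.Bc H (Sum.inl 0) (Sum.inl 1) p) * u2

/-- Closedness gives `v[h] = (tr D_v) h`. -/
theorem dirDeriv_h (h𝒢 : NilpotentLieGroup 3 𝒢) (hd : d = 3 + 1) (hU : IsOpen U)
    (hH : B.InvariantThreeForm H) (hc : ClosedThreeForm H) {p : P} (hp : p ∈ B.proj ⁻¹' U) :
    dirDeriv (E.v 0) (E.h H) p = E.trD p * E.h H p := by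
  have hz : ∀ i x y z, dirDeriv (E.e (Sum.inl i)) (evalForm H (E.e x) (E.e y) (E.e z)) p = 0 :=
    fun i x y z => (E.invariantOn_Hc hH x y z).mfderiv_eq_zero hd hp (E.vertical i p hp)
  have h0 := hc _ (B.isOpen_preimage hU)
    ![E.e (Sum.inr 0), E.e (Sum.inl 0), E.e (Sum.inl 1), E.e (Sum.inl 2)]
    (by intro i; fin_cases i <;> exact E.smooth _) p hp
  have hC := fun i j l => E.C_antisymm (Sum.inl i) (Sum.inl j) (Sum.inl l) p
  have u0 := E.sum_C_inl h𝒢 hd hU 0 hp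
  have u1 := E.sum_C_inl h𝒢 hd hU 1 hp
  have u2 := E.sum_C_inl h𝒢 hd hU 2 hp
  simp only [Fin.sum_univ_three, E.C_self] at u0 u1 u2
  rw [hC 0 1 0] at u1
  rw [hC 0 2 0, hC 1 2 1] at u2
  simp only [Matrix.cons_val, hz, E.evalForm_bracket hd _ _ _ _ hp, Fintype.sum_sum_type,
    Fin.sum_univ_three, Fin.sum_univ_one, E.C_inl_inr hd hU _ _ _ hp, Hc_self₀₁, Hc_self₀₂] at h0
  have e1 := E.Hc_swap₀₁ (H := H) (Sum.inl 0) (Sum.inl 1) (Sum.inl 2) p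
  have e2 := E.Hc_swap₀₁ (H := H) (Sum.inl 0) (Sum.inl 2) (Sum.inl 1) p
  have e3 := E.Hc_swap₁₂ (H := H) (Sum.inl 0) (Sum.inl 1) (Sum.inl 2) p
  have f := fun i j => E.Hc_swap₀₁ (H := H) (Sum.inr 0) (Sum.inl i) (Sum.inl j) p
  have g1 := E.Hc_swap₁₂ (H := H) (Sum.inr 0) (Sum.inl 0) (Sum.inl 1) p
  have g2 := E.Hc_swap₁₂ (H := H) (Sum.inr 0) (Sum.inl 0) (Sum.inl 2) p
  have g3 := E.Hc_swap₁₂ (H := H) (Sum.inr 0) (Sum.inl 1) (Sum.inl 2) p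
  rw [e3] at e2
  simp only [e1, e2, f, g1, g2, g3] at h0
  change dirDeriv (E.e (Sum.inr 0)) (E.Hc H (Sum.inl 0) (Sum.inl 1) (Sum.inl 2)) p = _
  unfold Hc at h0 ⊢
  simp only [trD, h, Hc, Fin.sum_univ_three]
  -- The terms in `H(v, η_i, η_j)` again carry traces of `ad` as coefficients; only `v[h]` and the
  -- brackets `[v, η_i]`, which add up to `τ h`, remain.
  linear_combination h0
    - (evalForm H (E.e (Sum.inr 0)) (E.e (Sum.inl 1)) (E.e (Sum.inl 2)) p) * u0
    + (evalForm H (E.e (Sum.inr 0)) (E.e (Sum.inl 0)) (E.e (Sum.inl 2)) p) * u1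
    - (evalForm H (E.e (Sum.inr 0)) (E.e (Sum.inl 0)) (E.e (Sum.inl 1)) p) * u2

theorem mdifferentiableAt_trD (hU : IsOpen U) {p : P} (hp : p ∈ B.proj ⁻¹' U) :
    MDifferentiableAt 𝓘(ℝ, Euc d) 𝓘(ℝ, ℝ) E.trD p := by
  have h := fun i => E.mdifferentiableAt_C hU (Sum.inr 0) (Sum.inl i) (Sum.inl i) hp
  have e : E.trD = fun q => E.C (Sum.inr 0) (Sum.inl 0) (Sum.inl 0) q
      + E.C (Sum.inr 0) (Sum.inl 1) (Sum.inl 1) q + E.C (Sum.inr 0) (Sum.inl 2) (Sum.inl 2) q := by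
    funext q
    simp only [trD, Fin.sum_univ_three]
  rw [e]
  exact ((h 0).add (h 1)).add (h 2)

/-- The unit field on a one-dimensional base is parallel, so `Δ` is `v[v[·]]`; apply `v[h] = τ h`
twice to `6 h²`. -/
theorem laplacian_vertNormSq (h𝒢 : NilpotentLieGroup 3 𝒢) (hd : d = 3 + 1) (hU : IsOpen U)
    (hg : B.InvariantMetric gbar) (hH : B.InvariantThreeForm H) (hs : SmoothThreeForm H)
    (hc : ClosedThreeForm H) {p : P} (hp : p ∈ B.proj ⁻¹' U) :
    E.laplacian (B.vertNormSq gbar H) p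
      = 24 * E.trD p ^ 2 * E.h H p ^ 2 + 12 * dirDeriv (E.v 0) E.trD p * E.h H p ^ 2 := by
  have hP := B.isOpen_preimage hU
  have hh : ∀ q ∈ B.proj ⁻¹' U, MDifferentiableAt 𝓘(ℝ, Euc d) 𝓘(ℝ, ℝ) (E.h H) q := fun q hq =>
    E.mdifferentiableAt_Hc hU hs _ _ _ hq
  have hhh : ∀ q ∈ B.proj ⁻¹' U, MDifferentiableAt 𝓘(ℝ, Euc d) 𝓘(ℝ, ℝ)
      (fun q => E.h H q * E.h H q) q := fun q hq => (hh q hq).mul (hh q hq)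
  have hsq : ∀ q ∈ B.proj ⁻¹' U,
      dirDeriv (E.v 0) (fun q => E.h H q * E.h H q) q = 2 * (E.trD q * (E.h H q * E.h H q)) := by
    intro q hq
    rw [dirDeriv_mul (hh q hq) (hh q hq), E.dirDeriv_h h𝒢 hd hU hH hc hq]
    ring
  have h1 : ∀ q ∈ B.proj ⁻¹' U, dirDeriv (E.v 0) (B.vertNormSq gbar H ∘ B.proj) q
      = 12 * (E.trD q * (E.h H q * E.h H q)) := by
    intro q hq
    have e : B.vertNormSq gbar H ∘ B.proj =ᶠ[𝓝 q] fun q => 6 * (E.h H q * E.h H q) := by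
      filter_upwards [hP.mem_nhds hq] with z hz
      rw [Function.comp_apply, E.vertNormSq_eq hd hg hH hz, sq]
    rw [dirDeriv_congr e, dirDeriv_const_mul _ (hhh q hq), hsq q hq]
    ring
  have h2 : dirDeriv (E.v 0) (B.vertNormSq gbar H ∘ B.proj)
      =ᶠ[𝓝 p] fun q => 12 * (E.trD q * (E.h H q * E.h H q)) := by
    filter_upwards [hP.mem_nhds hp] with z hz using h1 z hz
  have ht := E.mdifferentiableAt_trD hU hp
  have h3 := hhh p hp
  have h4 : MDifferentiableAt 𝓘(ℝ, Euc d) 𝓘(ℝ, ℝ)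
      (fun q => E.trD q * (E.h H q * E.h H q)) p := ht.mul h3
  simp only [laplacian, Fin.sum_univ_one, E.Γ_eq_zero, zero_mul, sub_zero]
  rw [dirDeriv_congr h2, dirDeriv_const_mul _ h4, dirDeriv_mul ht h3, hsq p hp]
  ring

theorem traceDGNormSq_eq (hU : IsOpen U) {p : P} (hp : p ∈ B.proj ⁻¹' U) :
    E.traceDGNormSq p = 4 * E.trD p ^ 2 := by
  simp only [traceDGNormSq, Fin.sum_univ_one, E.DG_eq hU _ _ _ hp, trD, Fin.sum_univ_three]
  ring

/-- The trace of `DG` is `-2τ`. The connection terms of the second derivative contribute `+∑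
DG_{il}²`, because `DG` is minus twice the symmetric part of `D_v`, and this cancels the quadratic
term. -/
theorem sum_DDG (hU : IsOpen U) {p : P} (hp : p ∈ B.proj ⁻¹' U) :
    ∑ i, E.DDG 0 0 i i p - ∑ i, ∑ l, E.DG 0 i l p * E.DG 0 l i p
      = -2 * dirDeriv (E.v 0) E.trD p := by
  have hC := fun i => E.mdifferentiableAt_C hU (Sum.inr 0) (Sum.inl i) (Sum.inl i) hp
  have h1 : ∀ i, dirDeriv (E.v 0) (E.DG 0 i i) p
      = -2 * dirDeriv (E.v 0) (E.C (Sum.inr 0) (Sum.inl i) (Sum.inl i)) p := by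
    intro i
    rw [← dirDeriv_const_mul _ (hC i)]
    apply dirDeriv_congr
    filter_upwards [(B.isOpen_preimage hU).mem_nhds hp] with q hq
    rw [E.DG_eq hU _ _ _ hq]
    ring
  have h2 : dirDeriv (E.v 0) E.trD p
      = ∑ i, dirDeriv (E.v 0) (E.C (Sum.inr 0) (Sum.inl i) (Sum.inl i)) p := dirDeriv_sum hC
  rw [h2]
  simp only [DDG, h1, E.Γ_eq_zero, conn, E.DG_eq hU _ _ _ hp, Fin.sum_univ_three, Fin.sum_univ_one]
  ring

/-- The six orderings of `(0, 1, 2)` give `6 h²`. A component with one horizontal index occurs with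
that index in either of the two contracted slots, hence the factor `2`. -/
theorem sum_H2 (p : P) :
    ∑ i, E.H2 H (Sum.inl i) (Sum.inl i) p = 6 * E.h H p ^ 2 + 2 * E.traceH2 H p := by
  have e1 := E.Hc_swap₀₁ (H := H) (Sum.inl 0) (Sum.inl 1) (Sum.inl 2) p
  have e2 := E.Hc_swap₀₁ (H := H) (Sum.inl 0) (Sum.inl 2) (Sum.inl 1) p
  have e3 := E.Hc_swap₁₂ (H := H) (Sum.inl 0) (Sum.inl 1) (Sum.inl 2) p
  have e4 := E.Hc_swap₁₂ (H := H) (Sum.inl 1) (Sum.inl 0) (Sum.inl 2) p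
  have e5 := E.Hc_swap₁₂ (H := H) (Sum.inl 2) (Sum.inl 0) (Sum.inl 1) p
  have f := fun i j => E.Hc_swap₀₁ (H := H) (Sum.inr 0) (Sum.inl i) (Sum.inl j) p
  have f' := fun i j => E.Hc_swap₁₂ (H := H) (Sum.inl i) (Sum.inr 0) (Sum.inl j) p
  have g1 := E.Hc_swap₁₂ (H := H) (Sum.inr 0) (Sum.inl 0) (Sum.inl 1) p
  have g2 := E.Hc_swap₁₂ (H := H) (Sum.inr 0) (Sum.inl 0) (Sum.inl 2) p
  have g3 := E.Hc_swap₁₂ (H := H) (Sum.inr 0) (Sum.inl 1) (Sum.inl 2) p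
  simp only [H2, traceH2, h, Fintype.sum_sum_type, Fin.sum_univ_three, Fin.sum_univ_one,
    Hc_self₀₁, Hc_self₀₂, Hc_self₁₂, f', f, e5, e4, e2, e1, e3, g1, g2, g3]
  ring

/-- After tracing, the two bracket terms are `|[,]|²` and `-½|[,]|²`. -/
theorem sum_rhsG (hd : d = 3 + 1) (hU : IsOpen U) {p : P} (hp : p ∈ B.proj ⁻¹' U) :
    ∑ i, E.rhsG H i i p = -2 * dirDeriv (E.v 0) E.trD p + (1 / 2) * E.bracketNormSq p
      + 3 * E.h H p ^ 2 + E.traceH2 H p := by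
  have h1 := E.sum_DDG hU hp
  have h2 := E.sum_H2 (H := H) p
  have h3 : ∑ i, ∑ l, gbar.inner p (bracket (E.η l) (E.η i) p) (bracket (E.η l) (E.η i) p)
      = E.bracketNormSq p := Finset.sum_comm
  have h4 : ∑ i, ∑ l, ∑ m, E.C (Sum.inl l) (Sum.inl m) (Sum.inl i) p
      * E.C (Sum.inl l) (Sum.inl m) (Sum.inl i) p = E.bracketNormSq p := by
    simp only [bracketNormSq, E.inner_bracket_self hd hU _ _ hp, sq]
    rw [Finset.sum_comm]
    exact Finset.sum_congr rfl fun l _ => Finset.sum_comm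
  simp only [rhsG, Fin.sum_univ_one, E.F_eq_zero, Finset.sum_add_distrib, Finset.sum_sub_distrib,
    ← Finset.mul_sum, h2, h3, h4]
  rw [h1]
  simp
  ring

end Frame

end

end NilFlow

end

/-! ### The evolution equation -/

theorem proposition3p3 {𝒢 P M : Type*}
    [TopologicalSpace 𝒢] [ChartedSpace (NilFlow.Euc 3) 𝒢] [Group 𝒢]
    [LieGroup 𝓘(ℝ, NilFlow.Euc 3) ∞ 𝒢]
    [TopologicalSpace P] [ChartedSpace (NilFlow.Euc 4) P] [IsManifold 𝓘(ℝ, NilFlow.Euc 4) ∞ P]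
    [TopologicalSpace M] [ChartedSpace (NilFlow.Euc 1) M] [IsManifold 𝓘(ℝ, NilFlow.Euc 1) ∞ M]
    (h𝒢 : NilFlow.NilpotentLieGroup 3 𝒢)
    (B : NilFlow.PrincipalBundle 3 1 4 𝒢 P M)
    (J : Set ℝ) (hJ : J.OrdConnected)
    (gbar : ℝ → NilFlow.Metric 4 P) (Hbar : ℝ → NilFlow.ThreeForm 4 P)
    (hsol : NilFlow.IsSolution B J gbar Hbar) :
    ∀ t ∈ J,
      ContMDiff 𝓘(ℝ, NilFlow.Euc 1) 𝓘(ℝ, ℝ) ∞ (B.vertNormSq (gbar t) (Hbar t)) ∧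
      ∀ U : Set M, IsOpen U → ∀ (E : NilFlow.Frame B (gbar t) U), ∀ p ∈ B.proj ⁻¹' U,
        HasDerivWithinAt (fun s => B.vertNormSq (gbar s) (Hbar s) (B.proj p))
          (E.laplacian (B.vertNormSq (gbar t) (Hbar t)) p
            - (1 / 2) * (B.vertNormSq (gbar t) (Hbar t) (B.proj p)) ^ 2
            - B.vertNormSq (gbar t) (Hbar t) (B.proj p) *
              ((1 / 2) * E.bracketNormSq p + E.traceDGNormSq p + E.traceH2 (Hbar t) p))
          J t := by
  have hd : 4 = 3 + 1 := rfl
  intro t ht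
  have hg := hsol.metric_invariant t ht
  have hH := hsol.form_invariant t ht
  have hs := hsol.form_smooth t ht
  have hc := hsol.form_closed t ht
  refine ⟨B.contMDiff_vertNormSq hd hg hH hs, fun U hU E p hp => ?_⟩
  have hN := E.vertNormSq_eq hd hg hH hp
  have hG : ∀ i j, HasDerivWithinAt (fun s => (Matrix.of fun i j =>
      (gbar s).form p (E.vec (Sum.inl i) p) (E.vec (Sum.inl j) p)) i j)
      (E.rhsG (Hbar t) i j p) J t := fun i j => hsol.eq_G t ht U hU E p hp i j
  have hh : HasDerivWithinAt (fun s => E.h (Hbar s) p) 0 J t := by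
    rw [← E.dB_inl h𝒢 hd hU hg hH hs hp]
    exact hsol.eq_H t ht U hU E p hp _ _ _
  have hmain := NilFlow.hasDerivWithinAt_norm hG
    (fun i j => by
      rw [Matrix.of_apply, E.form_vec _ _ hp]
      simp) hh
  refine (hmain.congr_deriv ?_).congr_of_mem (fun s hs => ?_) ht
  · rw [hN, E.laplacian_vertNormSq h𝒢 hd hU hg hH hs hc hp, E.sum_rhsG hd hU hp,
      E.traceDGNormSq_eq hU hp]
    ring
  -- The vertical space does not depend on time, so the frame of time `t` is still a vertical basis
  -- at time `s`, though no longer orthonormal; the Gram determinant accounts for this.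
  · rw [B.vertNormSq_proj hd (hsol.metric_invariant s hs) (hsol.form_invariant s hs),
      E.vertNormSqAt_eq_of_frame hd _ _ hp]
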